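/- Let $D\ge 1$, let $m$ be even, and index $n=m^D$ bosonic modes by $\{1,\dots,m\}^D$. For a direction $j\in\{1,\dots,D\}$, a left layer $U^{L,j}$ (resp. right layer $U^{R,j}$) is an $n\times n$ unitary matrix which is block diagonal, with an arbitrary unitary matrix on each block, with respect to the following partition of the modes into sets of size $1$ or $2$: $x$ and $y$ are in the same set if $x_i=y_i$ for all $i\neq j$, and $x_j,y_j$ are equal or are paired by $(1\,2)(3\,4)\cdots(m-1\,m)$ (resp. by $(1)(2\,3)\cdots(m-2\,m-1)(m)$). A step $U^{(i)}$ is a product of $2D$ layers $U^{L,1},\dots,U^{L,D},U^{R,1},\dots,U^{R,D}$ in any fixed order (the order and the blocks may be different for different $i$), and a depth-$d$ brickwork circuit is $U=U^{(d)}\cdots U^{(1)}$. Start with the product Gaussian state in which every mode is squeezed with parameter $s>0$, and evolve it by the linear optical unitary $U$. For integers $0\le k_j\le m$ let $\Gamma=\{x: 1\le x_j\le k_j \text{ for all } j\}$, with boundary area $$A_\Gamma=\sum_{j=1}^D \mathbf 1_{k_j<m}\prod_{\ell\ne j}k_\ell ,$$ let $\sigma(U)$ be the covariance matrix of the reduced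 state on $\Gamma$ (normalized so that the vacuum has covariance matrix $I$), and let $S_2(U)=\frac12\log\det\sigma(U)$ be its Rényi-2 entropy. (i) (Worst case) For every $d\in\mathbb N$ and every depth-$d$ brickwork circuit $U$, $$S_2(U)\le 4d\,A_\Gamma\log\cosh(2s).$$ (ii) (Average case) There is an absolute constant $C>0$, not depending on $D,m,d,s,k_1,\dots,k_D$ or the order of the layers, such that if all the $1\times1$ and $2\times 2$ blocks of the circuit are independent and Haar distributed and $d\ge2$, then $$\mathbf E\,S_2(U)\le C\sqrt{D\,d\log d}\;A_\Gamma\sinh^2(2s).$$ -/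

import Mathlib

noncomputable section

namespace BosonicBrickwork

open Matrix

/-! ### Gaussian states and the Rényi-2 entropy -/

section Gaussian

variable {ι : Type*} [Fintype ι] [DecidableEq ι]

/-- Covariance matrix (order of quadratures: all positions, then all momenta; the vacuum has
covariance matrix `1`) of the product state in which every mode is squeezed with parameter `s`. -/
def squeezedCov (s : ℝ) : Matrix (ι ⊕ ι) (ι ⊕ ι) ℝ :=
  diagonal (Sum.elim (fun _ => Real.exp (2 * s)) (fun _ => Real.exp (-(2 * s))))

/-- The real symplectic (orthogonal) matrix acting on the quadratures when the creation operators
undergo the linear optical transformation `a†_y ↦ ∑ x, U x y • a†_x`. -/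
def quadratureMatrix (U : Matrix ι ι ℂ) : Matrix (ι ⊕ ι) (ι ⊕ ι) ℝ :=
  fromBlocks (U.map Complex.re) (U.map Complex.im) (-(U.map Complex.im)) (U.map Complex.re)

/-- Covariance matrix of the state obtained by evolving the squeezed state by `U`. -/
def evolvedCov (s : ℝ) (U : Matrix ι ι ℂ) : Matrix (ι ⊕ ι) (ι ⊕ ι) ℝ :=
  quadratureMatrix U * squeezedCov s * (quadratureMatrix U)ᵀ

/-- Covariance matrix of the reduced state of the subsystem `Γ`: the rows and columns of the
quadratures of the modes in `Γ`. -/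
def reducedCov (s : ℝ) (Γ : Finset ι) (U : Matrix ι ι ℂ) : Matrix (Γ ⊕ Γ) (Γ ⊕ Γ) ℝ :=
  (evolvedCov s U).submatrix (Sum.map Subtype.val Subtype.val) (Sum.map Subtype.val Subtype.val)

/-- The Rényi-2 entropy `-log Tr ρ² = (1/2) log det σ` of the reduced Gaussian state on `Γ`, with
covariance matrix `σ`. -/
def renyi2 (s : ℝ) (Γ : Finset ι) (U : Matrix ι ι ℂ) : ℝ :=
  1 / 2 * Real.log (reducedCov s Γ U).det

/-- For unitary `U` the covariance matrix has the form `σ = cosh (2s) 1 + sinh (2s) M`, where `M` is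
made of the real and imaginary parts of `Ū Ūᵀ`. -/
theorem evolvedCov_eq (s : ℝ) (U : unitaryGroup ι ℂ) :
    evolvedCov s (U : Matrix ι ι ℂ) = Real.cosh (2 * s) • (1 : Matrix (ι ⊕ ι) (ι ⊕ ι) ℝ) +
      Real.sinh (2 * s) • fromBlocks
        (((U : Matrix ι ι ℂ).map star * ((U : Matrix ι ι ℂ).map star)ᵀ).map Complex.re)
        (((U : Matrix ι ι ℂ).map star * ((U : Matrix ι ι ℂ).map star)ᵀ).map Complex.im)
        (((U : Matrix ι ι ℂ).map star * ((U : Matrix ι ι ℂ).map star)ᵀ).map Complex.im)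
        (-((U : Matrix ι ι ℂ).map star * ((U : Matrix ι ι ℂ).map star)ᵀ).map Complex.re) := by
  set V : Matrix ι ι ℂ := (U : Matrix ι ι ℂ) with hV
  have hU : V * star V = 1 := Unitary.mul_star_self_of_mem U.2
  have h1 : V.map Complex.re * (V.map Complex.re)ᵀ + V.map Complex.im * (V.map Complex.im)ᵀ = 1 := by
    ext x y
    have h := congrArg Complex.re (congrFun (congrFun hU x) y)
    simp only [mul_apply, star_apply, Complex.re_sum, Complex.mul_re, Complex.star_def,
      Complex.conj_re, Complex.conj_im] at h
    simp only [Matrix.add_apply, mul_apply, map_apply, transpose_apply, ← Finset.sum_add_distrib]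
    refine Eq.trans (Finset.sum_congr rfl fun z _ => ?_) (h.trans ?_)
    · ring
    · by_cases hxy : x = y <;> simp [hxy, one_apply]
  have h2 : V.map Complex.im * (V.map Complex.re)ᵀ = V.map Complex.re * (V.map Complex.im)ᵀ := by
    ext x y
    have h := congrArg Complex.im (congrFun (congrFun hU x) y)
    simp only [mul_apply, star_apply, Complex.im_sum, Complex.mul_im, Complex.star_def,
      Complex.conj_re, Complex.conj_im] at h
    have h0 : ((1 : Matrix ι ι ℂ) x y).im = 0 := by
      by_cases hxy : x = y <;> simp [hxy, one_apply]
    rw [h0] at h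
    rw [← sub_eq_zero]
    simp only [mul_apply, map_apply, transpose_apply, ← Finset.sum_sub_distrib]
    rw [← h]
    exact Finset.sum_congr rfl fun z _ => by ring
  have h3 : (V.map star * (V.map star)ᵀ).map Complex.re =
      V.map Complex.re * (V.map Complex.re)ᵀ - V.map Complex.im * (V.map Complex.im)ᵀ := by
    ext x y
    simp [mul_apply]
  have h4 : (V.map star * (V.map star)ᵀ).map Complex.im =
      -(V.map Complex.re * (V.map Complex.im)ᵀ) - V.map Complex.im * (V.map Complex.re)ᵀ := by
    ext x y
    simp [mul_apply, Finset.sum_add_distrib]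
    ring
  have h5 : (squeezedCov s : Matrix (ι ⊕ ι) (ι ⊕ ι) ℝ) =
      fromBlocks (Real.exp (2 * s) • 1) 0 0 (Real.exp (-(2 * s)) • 1) := by
    ext (x | x) (y | y) <;> simp [squeezedCov, diagonal_apply, one_apply]
  rw [h3, h4, evolvedCov, quadratureMatrix, h5, fromBlocks_transpose, fromBlocks_multiply,
    fromBlocks_multiply, ← fromBlocks_one, fromBlocks_smul, fromBlocks_smul, fromBlocks_add,
    fromBlocks_inj, Real.cosh_eq, Real.sinh_eq]
  simp only [Matrix.mul_smul, Matrix.mul_one, Matrix.mul_zero, add_zero, zero_add, smul_zero,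
    Matrix.smul_mul, transpose_neg, Matrix.neg_mul, Matrix.mul_neg, h2, smul_neg, neg_neg]
  rw [← h1]
  refine ⟨?_, ?_, ?_, ?_⟩ <;> module

end Gaussian

/-! ### The brickwork circuit -/

/-- The modes: the points of the grid `{1, …, m}^D`, each coordinate being shifted by one. -/
abbrev Modes (D m : ℕ) : Type := Fin D → Fin m

variable {D m d : ℕ}

/-- A layer is given by a direction `j` and a side `b`, where `b = false` is the left brickwall
pattern `(1 2)(3 4)⋯(m-1 m)` and `b = true` the right one, `(1)(2 3)⋯(m-2 m-1)(m)`. Two modes lie in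
the same block of the layer iff they have the same label: their coordinates other than the `j`-th
agree and their `j`-th coordinates are matched with each other by the pattern (or are equal). -/
def blockLabel (l : Fin D × Bool) (x : Modes D m) : Fin D → ℕ :=
  fun i => if i = l.1 then ((x i : ℕ) + l.2.toNat) / 2 else x i

/-- The set of blocks of a layer, through their labels. -/
abbrev Blocks (D m : ℕ) (l : Fin D × Bool) : Type :=
  Set.range (blockLabel l : Modes D m → Fin D → ℕ)

/-- The modes of a block (one or two of them). -/
abbrev BlockModes {l : Fin D × Bool} (c : Blocks D m l) : Type :=
  {x : Modes D m // blockLabel l x = c.1}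

/-- The matrix of one layer, acting as the unitary `u c` on each block `c`. -/
def layer (l : Fin D × Bool) (u : ∀ c : Blocks D m l, unitaryGroup (BlockModes c) ℂ) :
    Matrix (Modes D m) (Modes D m) ℂ :=
  fun x y =>
    if h : blockLabel l y = blockLabel l x then
      (u ⟨blockLabel l x, x, rfl⟩).1 ⟨x, rfl⟩ ⟨y, h⟩
    else 0

/-- The positions of the `1 × 1` and `2 × 2` blocks in a circuit of depth `d`: a step, a layer in
it and a block of this layer. -/
abbrev GateIndex (D m d : ℕ) : Type := Σ p : Fin d × (Fin D × Bool), Blocks D m p.2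

/-- The unitary group in which the gate at a given position lives; it is `U(1)` or `U(2)`. -/
abbrev GateGroup (a : GateIndex D m d) : Type := unitaryGroup (BlockModes a.2) ℂ

/-- A choice of all gates of a circuit of depth `d`. -/
abbrev Gates (D m d : ℕ) : Type := ∀ a : GateIndex D m d, GateGroup a

/-- The `i`-th step of the circuit: the product of the `2D` layers, the layer `ord 0` being applied
first. -/
def step (ord : Fin (2 * D) ≃ Fin D × Bool) (u : Gates D m d) (i : Fin d) :
    Matrix (Modes D m) (Modes D m) ℂ :=
  (List.ofFn fun t => layer (ord t) fun c => u ⟨(i, ord t), c⟩).reverse.prod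

/-- The circuit `U⁽ᵈ⁾ ⋯ U⁽¹⁾` of depth `d`, where the order of the layers may vary with the step. -/
def circuit (ord : Fin d → (Fin (2 * D) ≃ Fin D × Bool)) (u : Gates D m d) :
    Matrix (Modes D m) (Modes D m) ℂ :=
  (List.ofFn fun i => step (ord i) u i).reverse.prod

/-- The box `{x : 1 ≤ x_j ≤ k_j for all j}` (with coordinates shifted by one). -/
def box (m : ℕ) (k : Fin D → ℕ) : Finset (Modes D m) :=
  Finset.univ.filter fun x => ∀ j, (x j : ℕ) < k j

/-- The boundary area of the box. -/
def boundaryArea (m : ℕ) (k : Fin D → ℕ) : ℕ :=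
  ∑ j, (if k j < m then 1 else 0) * ∏ l ∈ Finset.univ.erase j, k l

/-- The Borel `σ`-algebra of the unitary group. -/
instance {ι : Type*} [Fintype ι] [DecidableEq ι] : MeasurableSpace (unitaryGroup ι ℂ) := borel _

instance {ι : Type*} [Fintype ι] [DecidableEq ι] : BorelSpace (unitaryGroup ι ℂ) := ⟨rfl⟩

end BosonicBrickwork

end

open BosonicBrickwork MeasureTheory ProbabilityTheory

open BosonicBrickwork MeasureTheory ProbabilityTheory

/-! Let Q be the orthogonal action of U on quadratures. The evolved covariance is cosh(2s) +
sinh(2s) M with M = Q diag(1, -1) Qᵀ (`squeezePart`), a symmetric involution. Let N be the block of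
M with rows in Γ and columns outside. Conjugation by the symplectic form negates the restriction of
M to Γ, so (det σ)² = det(1 + sinh²(2s) N Nᵀ) (`det_reducedCov_sq`). As N Nᵀ has spectrum in [0, 1],
the entropy is controlled both by the rank and by the trace of N Nᵀ (`log_det_one_add_smul_le`).

Worst case: the rank of the off-diagonal block is subadditive under products (`rank_mul_cross_le`),
and a single layer in direction j contributes at most two quadratures per mode of the j-th face.

Average case: the trace is twice the sum of |(U Uᵀ) x y|² over x in Γ, y outside. Random phases of
the layer applied first reduce its mean to the probability that two particles started at the same
mode z end one inside and one outside Γ (`integral_sum_norm_sq`). A union bound over the face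
crossed, followed by dropping one constraint, leaves two events testing complementary sets of
directions. Every layer then acts on at most one of them, so invariance under swapping the modes of
a block suffices to compute the mean exactly, as a product of one-dimensional block averages
(`integral_weight_mul_weight`).

It remains to bound the mass leaking from an interval under N ≤ 2d block averages (`leak_bounds`).
One average raises the first moment of an antitone profile with values in [0, 1] by at most 1/2,
while moving mass ℓ across the cut at density at most 1 costs at least ℓ². Hence ℓ ≤ √(N/2) ≤ √d,
which gives a bound of order √d, without the factors D and log d. -/

namespace BosonicBrickwork

/-! ### Averaging over the blocks of a brickwall pattern in dimension one -/

/-- The partner of a site in the brickwall pattern of side `b` (the site itself if it is alone in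
its block). -/
def partner {m : ℕ} (b : Bool) (a : Fin m) : Fin m :=
  if h : (if ((a : ℕ) + b.toNat) % 2 = 0 then (a : ℕ) + 1 else (a : ℕ) - 1) < m then ⟨_, h⟩ else a

theorem partner_val {m : ℕ} (b : Bool) (a : Fin m) : (partner b a : ℕ) =
    if (if ((a : ℕ) + b.toNat) % 2 = 0 then (a : ℕ) + 1 else (a : ℕ) - 1) < m then
      (if ((a : ℕ) + b.toNat) % 2 = 0 then (a : ℕ) + 1 else (a : ℕ) - 1) else a := by
  unfold partner
  by_cases h : (if ((a : ℕ) + b.toNat) % 2 = 0 then (a : ℕ) + 1 else (a : ℕ) - 1) < m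
  · rw [dif_pos h, if_pos h]
  · rw [dif_neg h, if_neg h]

theorem partner_label {m : ℕ} (b : Bool) (a : Fin m) :
    ((partner b a : ℕ) + b.toNat) / 2 = ((a : ℕ) + b.toNat) / 2 := by
  rw [partner_val]
  cases b <;> simp only [Bool.toNat_true, Bool.toNat_false] <;> split_ifs <;> omega

theorem eq_or_eq_partner {m : ℕ} (b : Bool) {a c : Fin m}
    (h : ((c : ℕ) + b.toNat) / 2 = ((a : ℕ) + b.toNat) / 2) : c = a ∨ c = partner b a := by
  have h1 := a.2
  have h2 := c.2
  rw [Fin.ext_iff, Fin.ext_iff, partner_val]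
  revert h
  cases b <;> simp only [Bool.toNat_true, Bool.toNat_false] <;> intro h <;> split_ifs <;> omega

theorem partner_partner {m : ℕ} (b : Bool) (a : Fin m) : partner b (partner b a) = a := by
  have h1 := a.2
  rw [Fin.ext_iff, partner_val, partner_val]
  cases b <;> simp only [Bool.toNat_true, Bool.toNat_false] <;> split_ifs <;> omega

/-- The only order reversal happens inside a block, where block averages coincide; this is why
averaging preserves antitonicity. -/
theorem partner_mono {m : ℕ} (b : Bool) {a c : Fin m} (h : a < c) :
    partner b a ≤ partner b c ∨ (c = partner b a ∧ a = partner b c) := by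
  have h1 := a.2
  have h2 := c.2
  rw [Fin.lt_def] at h
  rw [Fin.le_def, Fin.ext_iff, Fin.ext_iff, partner_val, partner_val]
  cases b <;> simp only [Bool.toNat_true, Bool.toNat_false] <;> split_ifs <;> omega

/-- The average of a function over the blocks of a brickwall pattern. -/
noncomputable def blockAvg {m : ℕ} (b : Bool) (f : Fin m → ℝ) (a : Fin m) : ℝ :=
  (f a + f (partner b a)) / 2

theorem sum_comp_partner {m : ℕ} (b : Bool) (f : Fin m → ℝ) :
    ∑ a, f (partner b a) = ∑ a, f a :=
  Equiv.sum_comp (Function.Involutive.toPerm _ (partner_partner b)) f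

theorem sum_blockAvg {m : ℕ} (b : Bool) (f : Fin m → ℝ) : ∑ a, blockAvg b f a = ∑ a, f a := by
  simp only [blockAvg, ← Finset.sum_div, Finset.sum_add_distrib, sum_comp_partner]
  ring

theorem antitone_blockAvg {m : ℕ} (b : Bool) {f : Fin m → ℝ} (hf : Antitone f) :
    Antitone (blockAvg b f) := by
  intro a c hac
  rcases hac.eq_or_lt with rfl | h
  · exact le_rfl
  · unfold blockAvg
    rcases partner_mono b h with h' | ⟨h1, h2⟩
    · linarith [hf hac, hf h']
    · rw [← h1, ← h2]; linarith

/-- The displacement is +1 at the lower and -1 at the upper site of a pair, and 0 at singletons. The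
sum is therefore one of differences of `f` over disjoint pairs, bounded by the total drop of `f`. -/
theorem sum_mul_partner_sub_le {m : ℕ} (b : Bool) {f : Fin m → ℝ} (hf : Antitone f)
    (h0 : ∀ a, 0 ≤ f a) (h1 : ∀ a, f a ≤ 1) :
    ∑ a, f a * ((partner b a : ℕ) - (a : ℕ) : ℝ) ≤ 1 := by
  -- Extension by zero keeps the function antitone because `f` is nonnegative, and makes it vanish
  -- at `m`.
  set F : ℕ → ℝ := fun n => if h : n < m then f ⟨n, h⟩ else 0 with hF
  have hF0 : ∀ n, 0 ≤ F n := by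
    intro n; simp only [hF]; split_ifs
    · exact h0 _
    · exact le_rfl
  have hF1 : ∀ n, F n ≤ 1 := by
    intro n; simp only [hF]; split_ifs
    · exact h1 _
    · exact zero_le_one
  have hanti : ∀ n, F (n + 1) ≤ F n := by
    intro n
    by_cases h : n + 1 < m
    · have h' : n < m := by omega
      simp only [hF, h, h', dif_pos]
      exact hf (by simp)
    · have h' : F (n + 1) = 0 := by simp [hF, h]
      rw [h']; exact hF0 n
  -- The two zero values are the possible singletons at the right and left ends.
  set δ : ℕ → ℝ := fun n => if (n + b.toNat) % 2 = 0 then (if n + 1 < m then 1 else 0) else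
    (if n = 0 then 0 else -1) with hδ
  -- Strengthened induction: at the start of a block the budget must still have room for `F n`,
  -- which the lower site of a pair then spends.
  have key : ∀ n, n ≤ m → ∑ i ∈ Finset.range n, F i * δ i +
      (if (n + b.toNat) % 2 = 0 ∨ n = 0 then F n else 0) ≤ 1 := by
    intro n
    induction n with
    | zero => intro _; simpa using hF1 0
    | succ n ih =>
      intro hn
      have ih := ih (by omega)
      rw [Finset.sum_range_succ]
      have := hanti n
      have hn0 := hF0 n
      have hlast : ¬ n + 1 < m → F (n + 1) = 0 := fun h => by simp [hF, h]
      by_cases hp : (n + b.toNat) % 2 = 0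
      · have hp' : ¬ ((n + 1 + b.toNat) % 2 = 0 ∨ n + 1 = 0) := by omega
        rw [if_pos (Or.inl hp)] at ih
        rw [if_neg hp']
        simp only [hδ, hp, if_true]
        split_ifs <;> linarith
      · have hp' : ((n + 1 + b.toNat) % 2 = 0 ∨ n + 1 = 0) := by omega
        rw [if_pos hp']
        simp only [hδ, hp, if_false]
        by_cases h0 : n = 0
        · rw [if_pos (Or.inr h0)] at ih
          rw [if_pos h0]; linarith
        · rw [if_neg (by tauto)] at ih
          rw [if_neg h0]; linarith
  have hsum : ∑ a, f a * ((partner b a : ℕ) - (a : ℕ) : ℝ) =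
      ∑ i ∈ Finset.range m, F i * δ i := by
    rw [← Fin.sum_univ_eq_sum_range (fun i => F i * δ i)]
    refine Finset.sum_congr rfl fun a _ => ?_
    have ha := a.2
    have e1 : F a = f a := by simp [hF]
    rw [e1]
    congr 1
    simp only [hδ]
    rw [partner_val]
    by_cases hp : ((a : ℕ) + b.toNat) % 2 = 0
    · by_cases h : (a : ℕ) + 1 < m <;> simp [hp, h]
    · have h3 : (a : ℕ) - 1 < m := by omega
      simp only [hp, if_false, h3, if_true]
      by_cases h : (a : ℕ) = 0
      · simp [h]
      · rw [if_neg h, Nat.cast_sub (by omega)]; simp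
  rw [hsum]
  have h := key m le_rfl
  have : F m = 0 := by simp [hF]
  simpa [this] using h

/-- Averaging is self-adjoint, so the moment changes by half of the displacement sum of
`sum_mul_partner_sub_le`. -/
theorem sum_mul_blockAvg_le {m : ℕ} (b : Bool) {f : Fin m → ℝ} (hf : Antitone f)
    (h0 : ∀ a, 0 ≤ f a) (h1 : ∀ a, f a ≤ 1) :
    ∑ a : Fin m, (a : ℝ) * blockAvg b f a ≤ ∑ a : Fin m, (a : ℝ) * f a + 1 / 2 := by
  have h := sum_mul_partner_sub_le b hf h0 h1
  have e : ∑ a : Fin m, (a : ℝ) * f (partner b a) = ∑ a, ((partner b a : ℕ) : ℝ) * f a := by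
    rw [← sum_comp_partner b fun a : Fin m => (((partner b a : Fin m) : ℕ) : ℝ) * f a]
    simp only [partner_partner]
  have e2 : ∑ a : Fin m, (a : ℝ) * blockAvg b f a =
      (∑ a : Fin m, (a : ℝ) * f a + ∑ a : Fin m, (a : ℝ) * f (partner b a)) / 2 := by
    rw [← Finset.sum_add_distrib, Finset.sum_div]
    exact Finset.sum_congr rfl fun a _ => by unfold blockAvg; ring
  have e3 : ∑ a, f a * ((partner b a : ℕ) - (a : ℕ) : ℝ) =
      ∑ a : Fin m, ((partner b a : ℕ) : ℝ) * f a - ∑ a : Fin m, (a : ℝ) * f a := by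
    rw [← Finset.sum_sub_distrib]
    exact Finset.sum_congr rfl fun a _ => by ring
  rw [e2, e]
  linarith

/-! ### Iterated averages and the mass leaking from an interval -/

/-- Averaging over the blocks of a sequence of patterns, the head of the list being applied
first. -/
noncomputable def iterAvg {m : ℕ} : List Bool → (Fin m → ℝ) → Fin m → ℝ
  | [], f => f
  | b :: l, f => iterAvg l (blockAvg b f)

theorem sum_iterAvg {m : ℕ} (l : List Bool) (f : Fin m → ℝ) :
    ∑ a, iterAvg l f a = ∑ a, f a := by
  induction l generalizing f with
  | nil => rfl
  | cons b l ih => exact (ih _).trans (sum_blockAvg b f)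

theorem iterAvg_one_sub {m : ℕ} (l : List Bool) (f : Fin m → ℝ) (a : Fin m) :
    iterAvg l (fun c => 1 - f c) a = 1 - iterAvg l f a := by
  induction l generalizing f with
  | nil => rfl
  | cons b l ih =>
    rw [iterAvg, iterAvg, ← ih]
    congr 1
    funext c
    unfold blockAvg
    ring

theorem iterAvg_nonneg {m : ℕ} (l : List Bool) {f : Fin m → ℝ} (hf : ∀ a, 0 ≤ f a) (a : Fin m) :
    0 ≤ iterAvg l f a := by
  induction l generalizing f with
  | nil => exact hf a
  | cons b l ih => exact ih fun c => div_nonneg (add_nonneg (hf _) (hf _)) zero_le_two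

theorem iterAvg_le_one {m : ℕ} (l : List Bool) {f : Fin m → ℝ} (hf : ∀ a, f a ≤ 1) (a : Fin m) :
    iterAvg l f a ≤ 1 := by
  have h := iterAvg_nonneg l (f := fun c => 1 - f c) (fun c => by linarith [hf c]) a
  rw [iterAvg_one_sub] at h
  linarith

theorem sum_mul_iterAvg_le {m : ℕ} (l : List Bool) {f : Fin m → ℝ} (hf : Antitone f)
    (h0 : ∀ a, 0 ≤ f a) (h1 : ∀ a, f a ≤ 1) :
    ∑ a : Fin m, (a : ℝ) * iterAvg l f a ≤ ∑ a : Fin m, (a : ℝ) * f a + l.length / 2 := by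
  induction l generalizing f with
  | nil => simp [iterAvg]
  | cons b l ih =>
    have h := ih (antitone_blockAvg b hf) (iterAvg_nonneg [b] h0) (iterAvg_le_one [b] h1)
    have h' := sum_mul_blockAvg_le b hf h0 h1
    rw [iterAvg, List.length_cons]
    push_cast
    linarith

/-- A density bounded by `1` of mass `ℓ` on the half-line has first moment at least `ℓ² / 2`. -/
theorem sq_sum_range_le (n : ℕ) (a : ℕ → ℝ) (h0 : ∀ i, 0 ≤ a i) (h1 : ∀ i, a i ≤ 1) :
    (∑ i ∈ Finset.range n, a i) ^ 2 ≤ 2 * ∑ i ∈ Finset.range n, ((i : ℝ) + 1 / 2) * a i := by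
  induction n with
  | zero => simp
  | succ n ih =>
    -- With S the partial sum, the increment 2 S a + a² of the square is at most (2n + 1) a, as S ≤
    -- n and a ≤ 1; hence the midpoint weights i + 1/2.
    have hle : ∑ i ∈ Finset.range n, a i ≤ n := by
      simpa using Finset.sum_le_sum (s := Finset.range n) fun i _ => h1 i
    rw [Finset.sum_range_succ, Finset.sum_range_succ]
    nlinarith [h0 n, h1 n, mul_le_mul_of_nonneg_right hle (h0 n),
      mul_le_mul_of_nonneg_left (h1 n) (h0 n)]

/-- The mass which leaks out of `{0, …, k - 1}` under `N` averagings is at most `√(N / 2)`, and so is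
the missing mass inside of this interval. -/
theorem leak_bounds {m k : ℕ} (hk : k ≤ m) (l : List Bool) :
    (∑ a : Fin m, if (a : ℕ) < k then
        1 - iterAvg l (fun c : Fin m => if (c : ℕ) < k then 1 else 0) a
      else iterAvg l (fun c : Fin m => if (c : ℕ) < k then 1 else 0) a) ≤
      2 * Real.sqrt (l.length / 2) := by
  set f : Fin m → ℝ := fun c => if (c : ℕ) < k then 1 else 0 with hf
  have hanti : Antitone f := by
    intro a c hac
    simp only [hf]
    have : (a : ℕ) ≤ c := hac
    split_ifs <;> first | omega | norm_num
  have h0 : ∀ a, 0 ≤ f a := fun a => by simp only [hf]; split_ifs <;> norm_num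
  have h1 : ∀ a, f a ≤ 1 := fun a => by simp only [hf]; split_ifs <;> norm_num
  have hmass := sum_iterAvg l f
  have hmom := sum_mul_iterAvg_le l hanti h0 h1
  have g0 := iterAvg_nonneg l h0
  have g1 := iterAvg_le_one l h1
  set g := iterAvg l f with hg
  obtain ⟨r, rfl⟩ := Nat.exists_eq_add_of_le hk
  set G : ℕ → ℝ := fun n => if h : n < k + r then g ⟨n, h⟩ else 0 with hG
  have G0 : ∀ n, 0 ≤ G n := by
    intro n; simp only [hG]; split_ifs
    · exact g0 _
    · exact le_rfl
  have G1 : ∀ n, G n ≤ 1 := by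
    intro n; simp only [hG]; split_ifs
    · exact g1 _
    · exact zero_le_one
  have conv : ∀ (φ : ℕ → ℝ → ℝ), ∑ a : Fin (k + r), φ a (g a) =
      ∑ i ∈ Finset.range k, φ i (G i) + ∑ i ∈ Finset.range r, φ (k + i) (G (k + i)) := by
    intro φ
    rw [← Finset.sum_range_add (fun i => φ i (G i)), ← Fin.sum_univ_eq_sum_range]
    exact Finset.sum_congr rfl fun a _ => by simp [hG]
  have convf : ∀ (φ : ℕ → ℝ), ∑ a : Fin (k + r), φ a * f a = ∑ i ∈ Finset.range k, φ i := by
    intro φ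
    have : ∑ a : Fin (k + r), φ a * f a =
        ∑ i ∈ Finset.range (k + r), φ i * if i < k then 1 else 0 := by
      rw [← Fin.sum_univ_eq_sum_range]
    rw [this, Finset.sum_range_add]
    have e2 : ∑ i ∈ Finset.range r, (φ (k + i) * if k + i < k then (1 : ℝ) else 0) = 0 :=
      Finset.sum_eq_zero fun i _ => by simp
    rw [e2, add_zero]
    exact Finset.sum_congr rfl fun i hi => by simp [Finset.mem_range.1 hi]
  have cm := conv fun _ x => x
  have cM := conv fun i x => (i : ℝ) * x
  have fm := convf fun _ => 1
  have fM := convf fun i => (i : ℝ)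
  have cl := conv fun i x => if i < k then 1 - x else x
  simp only [one_mul, Finset.sum_const, Finset.card_range, nsmul_eq_mul, mul_one] at fm
  rw [cl]
  set out := ∑ i ∈ Finset.range r, G (k + i) with hout
  have e1 : ∑ i ∈ Finset.range r, (if k + i < k then 1 - G (k + i) else G (k + i)) = out :=
    Finset.sum_congr rfl fun i _ => by simp
  have e2 : ∑ i ∈ Finset.range k, (if i < k then 1 - G i else G i) =
      ∑ i ∈ Finset.range k, (1 - G i) :=
    Finset.sum_congr rfl fun i hi => by simp [Finset.mem_range.1 hi]
  -- Conservation of mass: what is missing inside equals what has leaked outside.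
  have e3 : ∑ i ∈ Finset.range k, (1 - G i) = out := by
    rw [Finset.sum_sub_distrib]; simp only [Finset.sum_const, Finset.card_range, nsmul_eq_mul,
      mul_one]; linarith
  rw [e1, e2, e3]
  -- The moment bound is applied to the leaked density read outwards from the cut at k - 1/2, and to
  -- the deficit read inwards from it. When added, the two bounds give 2 out² ≤ 2 (final moment -
  -- initial moment) ≤ N, where N is the number of averages.
  have s1 := sq_sum_range_le r (fun i => G (k + i)) (fun i => G0 _) (fun i => G1 _)
  have s2 := sq_sum_range_le k (fun i => 1 - G (k - 1 - i)) (fun i => by linarith [G1 (k - 1 - i)])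
    (fun i => by linarith [G0 (k - 1 - i)])
  rw [Finset.sum_range_reflect (fun i => 1 - G i) k, e3] at s2
  have e4 : ∑ i ∈ Finset.range k, ((i : ℝ) + 1 / 2) * (1 - G (k - 1 - i)) =
      ∑ i ∈ Finset.range k, ((k : ℝ) - 1 / 2 - i) * (1 - G i) := by
    rw [← Finset.sum_range_reflect (fun i => ((k : ℝ) - 1 / 2 - i) * (1 - G i)) k]
    refine Finset.sum_congr rfl fun i hi => ?_
    have : ((k - 1 - i : ℕ) : ℝ) = k - 1 - i := by
      have := Finset.mem_range.1 hi
      rw [Nat.cast_sub (by omega), Nat.cast_sub (by omega)]; simp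
    rw [this]; ring
  have e5 : ∑ i ∈ Finset.range k, ((k : ℝ) - 1 / 2 - i) * (1 - G i) =
      ((k : ℝ) - 1 / 2) * out - (∑ i ∈ Finset.range k, (i : ℝ) -
        ∑ i ∈ Finset.range k, (i : ℝ) * G i) := by
    rw [← e3, Finset.mul_sum, ← Finset.sum_sub_distrib, ← Finset.sum_sub_distrib]
    exact Finset.sum_congr rfl fun i _ => by ring
  have e6 : ∑ i ∈ Finset.range r, ((i : ℝ) + 1 / 2) * G (k + i) =
      ∑ i ∈ Finset.range r, ((k + i : ℕ) : ℝ) * G (k + i) - ((k : ℝ) - 1 / 2) * out := by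
    rw [hout, Finset.mul_sum, ← Finset.sum_sub_distrib]
    exact Finset.sum_congr rfl fun i _ => by push_cast; ring
  rw [e4, e5] at s2
  rw [← hout, e6] at s1
  have : out ^ 2 ≤ l.length / 2 := by linarith
  have := Real.le_sqrt_of_sq_le this
  linarith

open Matrix

/-! ### Bounds on the Rényi-2 entropy -/

theorem det_one_add_smul_eq_prod {κ : Type*} [Fintype κ] [DecidableEq κ] {K : Matrix κ κ ℝ}
    (hK : K.IsHermitian) (t : ℝ) :
    (1 + t • K).det = ∏ i, (1 + t * hK.eigenvalues i) := by
  have h := hK.spectral_theorem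
  set V := hK.eigenvectorUnitary
  have hV : (V : Matrix κ κ ℝ) * star (V : Matrix κ κ ℝ) = 1 := Unitary.coe_mul_star_self V
  have e : 1 + t • K = (V : Matrix κ κ ℝ) *
      diagonal (fun i => 1 + t * hK.eigenvalues i) * star (V : Matrix κ κ ℝ) := by
    have hd : (diagonal (fun i => 1 + t * hK.eigenvalues i) : Matrix κ κ ℝ) =
        1 + t • diagonal (RCLike.ofReal ∘ hK.eigenvalues) := by
      ext i j
      by_cases hij : i = j <;> simp [hij, one_apply]
    rw [hd, Matrix.mul_add, Matrix.add_mul, Matrix.mul_one, hV, Matrix.mul_smul, Matrix.smul_mul]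
    congr 2
  rw [e, det_mul, det_mul, mul_right_comm, ← det_mul, hV, det_one, one_mul, det_diagonal]

/-- At an eigenvector v, the quadratic form of 1 - K equals |B v|² ≥ 0. -/
theorem eigenvalues_le_one {κ : Type*} [Fintype κ] [DecidableEq κ] {K B : Matrix κ κ ℝ}
    (hK : K.IsHermitian) (hB : 1 - K = Bᵀ * B) (i : κ) : hK.eigenvalues i ≤ 1 := by
  have hv := hK.mulVec_eigenvectorBasis i
  set v : κ → ℝ := (hK.eigenvectorBasis i).ofLp
  have hv0 : v ≠ 0 := by
    intro h
    have := hK.eigenvectorBasis.toBasis.ne_zero i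
    apply this
    rw [OrthonormalBasis.coe_toBasis]
    ext j
    exact congrFun h j
  have hpos : 0 < v ⬝ᵥ v := by
    rcases (dotProduct_self_star_nonneg v).eq_or_lt with h | h
    · exact absurd (dotProduct_self_eq_zero.1 h.symm) hv0
    · exact h
  have h1 : v ⬝ᵥ ((1 - K) *ᵥ v) = (1 - hK.eigenvalues i) * (v ⬝ᵥ v) := by
    rw [Matrix.sub_mulVec, one_mulVec, hv, dotProduct_sub, dotProduct_smul, smul_eq_mul]; ring
  have h2 : v ⬝ᵥ ((1 - K) *ᵥ v) = (B *ᵥ v) ⬝ᵥ (B *ᵥ v) := by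
    rw [hB, ← mulVec_mulVec, dotProduct_mulVec, vecMul_transpose]
  have h3 : 0 ≤ (1 - hK.eigenvalues i) * (v ⬝ᵥ v) := by
    rw [← h1, h2]; exact dotProduct_self_star_nonneg _
  by_contra! h
  nlinarith

/-- The determinant is the product of 1 + tλ over eigenvalues λ in [0, 1]. At most rank-many are
nonzero, each contributing at most log(1 + t), which serves the worst case; log(1 + tλ) ≤ tλ yields
the trace bound for the average case. -/
theorem log_det_one_add_smul_le {κ ν : Type*} [Fintype κ] [DecidableEq κ] [Fintype ν]
    (N : Matrix κ ν ℝ) {B : Matrix κ κ ℝ} (hB : 1 - N * Nᵀ = Bᵀ * B) {t : ℝ} (ht : 0 ≤ t) :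
    0 < (1 + t • (N * Nᵀ)).det ∧
    Real.log (1 + t • (N * Nᵀ)).det ≤ N.rank * Real.log (1 + t) ∧
    Real.log (1 + t • (N * Nᵀ)).det ≤ t * (N * Nᵀ).trace := by
  have hK : (N * Nᵀ).IsHermitian := by
    rw [IsHermitian, conjTranspose_eq_transpose_of_trivial, transpose_mul, transpose_transpose]
  have hP : (N * Nᵀ).PosSemidef := by
    have := posSemidef_self_mul_conjTranspose N
    rwa [conjTranspose_eq_transpose_of_trivial] at this
  have h0 : ∀ i, 0 ≤ hK.eigenvalues i := hP.eigenvalues_nonneg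
  have h1 : ∀ i, hK.eigenvalues i ≤ 1 := eigenvalues_le_one hK hB
  have hpos : ∀ i, 0 < 1 + t * hK.eigenvalues i := fun i => by
    have := mul_nonneg ht (h0 i); linarith
  rw [det_one_add_smul_eq_prod hK]
  refine ⟨Finset.prod_pos fun i _ => hpos i, ?_, ?_⟩
  · rw [Real.log_prod fun i _ => (hpos i).ne']
    have hr : Fintype.card {i // hK.eigenvalues i ≠ 0} ≤ N.rank := by
      rw [← hK.rank_eq_card_non_zero_eigs]; exact rank_mul_le_left _ _
    have hlog : 0 ≤ Real.log (1 + t) := Real.log_nonneg (by linarith)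
    calc ∑ i, Real.log (1 + t * hK.eigenvalues i)
        ≤ ∑ i, if hK.eigenvalues i ≠ 0 then Real.log (1 + t) else 0 := by
          refine Finset.sum_le_sum fun i _ => ?_
          split_ifs with h
          · exact Real.log_le_log (hpos i) (by nlinarith [h1 i])
          · push Not at h; simp [h]
      _ = (Fintype.card {i // hK.eigenvalues i ≠ 0} : ℝ) * Real.log (1 + t) := by
          rw [← Finset.sum_filter, Finset.sum_const, nsmul_eq_mul, Fintype.card_subtype]
      _ ≤ N.rank * Real.log (1 + t) := by gcongr
  · rw [Real.log_prod fun i _ => (hpos i).ne', hK.trace_eq_sum_eigenvalues, Finset.mul_sum]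
    refine Finset.sum_le_sum fun i _ => ?_
    have := Real.log_le_sub_one_of_pos (hpos i)
    simp only [RCLike.ofReal_real_eq_id, id]
    linarith

/-! ### Reduced covariance matrix through the block coupling Γ to its complement -/

section Gaussian

variable {ι : Type*} [Fintype ι] [DecidableEq ι]

theorem quadratureMatrix_mul (U V : Matrix ι ι ℂ) :
    quadratureMatrix (U * V) = quadratureMatrix U * quadratureMatrix V := by
  have h1 : (U * V).map Complex.re =
      U.map Complex.re * V.map Complex.re - U.map Complex.im * V.map Complex.im := by
    ext x y; simp [mul_apply]
  have h2 : (U * V).map Complex.im =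
      U.map Complex.re * V.map Complex.im + U.map Complex.im * V.map Complex.re := by
    ext x y; simp [mul_apply, Finset.sum_add_distrib]
  rw [quadratureMatrix, quadratureMatrix, quadratureMatrix, fromBlocks_multiply, h1, h2,
    fromBlocks_inj]
  refine ⟨?_, ?_, ?_, ?_⟩ <;> noncomm_ring

theorem quadratureMatrix_one : quadratureMatrix (1 : Matrix ι ι ℂ) = 1 := by
  rw [quadratureMatrix, ← fromBlocks_one, fromBlocks_inj]
  refine ⟨?_, ?_, ?_, ?_⟩ <;> ext x y <;> by_cases h : x = y <;> simp [h, one_apply]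

theorem quadratureMatrix_star (U : Matrix ι ι ℂ) :
    quadratureMatrix (star U) = (quadratureMatrix U)ᵀ := by
  rw [quadratureMatrix, quadratureMatrix, fromBlocks_transpose, fromBlocks_inj]
  refine ⟨?_, ?_, ?_, ?_⟩ <;> ext x y <;> simp [star_apply]

/-- The matrix `diag(1, -1)` on the quadratures. -/
noncomputable def signMatrix : Matrix (ι ⊕ ι) (ι ⊕ ι) ℝ := diagonal (Sum.elim (fun _ => 1) fun _ => -1)

/-- The part of the evolved covariance matrix proportional to `sinh (2s)`. -/
noncomputable def squeezePart (U : Matrix ι ι ℂ) : Matrix (ι ⊕ ι) (ι ⊕ ι) ℝ :=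
  quadratureMatrix U * signMatrix * (quadratureMatrix U)ᵀ

theorem squeezedCov_eq (s : ℝ) : (squeezedCov s : Matrix (ι ⊕ ι) (ι ⊕ ι) ℝ) =
    Real.cosh (2 * s) • 1 + Real.sinh (2 * s) • signMatrix := by
  rw [← diagonal_one, squeezedCov, signMatrix, ← diagonal_smul, ← diagonal_smul, diagonal_add]
  congr 1
  funext i
  rcases i with i | i <;> simp [Real.cosh_eq, Real.sinh_eq] <;> ring

theorem quadratureMatrix_mul_transpose (U : unitaryGroup ι ℂ) :
    quadratureMatrix (U : Matrix ι ι ℂ) * (quadratureMatrix (U : Matrix ι ι ℂ))ᵀ = 1 := by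
  rw [← quadratureMatrix_star, ← quadratureMatrix_mul, Unitary.mul_star_self_of_mem U.2,
    quadratureMatrix_one]

theorem transpose_mul_quadratureMatrix (U : unitaryGroup ι ℂ) :
    (quadratureMatrix (U : Matrix ι ι ℂ))ᵀ * quadratureMatrix (U : Matrix ι ι ℂ) = 1 :=
  mul_eq_one_comm.1 (quadratureMatrix_mul_transpose U)

theorem evolvedCov_eq_add (s : ℝ) (U : unitaryGroup ι ℂ) :
    evolvedCov s (U : Matrix ι ι ℂ) =
      Real.cosh (2 * s) • 1 + Real.sinh (2 * s) • squeezePart (U : Matrix ι ι ℂ) := by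
  rw [evolvedCov, squeezedCov_eq, squeezePart, Matrix.mul_add, Matrix.add_mul, Matrix.mul_smul,
    Matrix.smul_mul, Matrix.mul_one, quadratureMatrix_mul_transpose, Matrix.mul_smul,
    Matrix.smul_mul]

theorem signMatrix_mul_self : (signMatrix : Matrix (ι ⊕ ι) (ι ⊕ ι) ℝ) * signMatrix = 1 := by
  rw [signMatrix, diagonal_mul_diagonal, ← diagonal_one]
  congr 1
  funext i
  rcases i with i | i <;> simp

theorem squeezePart_transpose (U : Matrix ι ι ℂ) : (squeezePart U)ᵀ = squeezePart U := by
  rw [squeezePart, transpose_mul, transpose_mul, transpose_transpose, Matrix.mul_assoc, signMatrix,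
    diagonal_transpose]

/-- This encodes the purity of the global state; it turns the deficit of the restriction to Γ into
the coupling with the complement. -/
theorem squeezePart_mul_self (U : unitaryGroup ι ℂ) :
    squeezePart (U : Matrix ι ι ℂ) * squeezePart (U : Matrix ι ι ℂ) = 1 := by
  rw [squeezePart]
  calc quadratureMatrix (U : Matrix ι ι ℂ) * signMatrix * (quadratureMatrix (U : Matrix ι ι ℂ))ᵀ *
        (quadratureMatrix (U : Matrix ι ι ℂ) * signMatrix *
          (quadratureMatrix (U : Matrix ι ι ℂ))ᵀ)
      = quadratureMatrix (U : Matrix ι ι ℂ) * signMatrix *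
        ((quadratureMatrix (U : Matrix ι ι ℂ))ᵀ * quadratureMatrix (U : Matrix ι ι ℂ)) *
          signMatrix * (quadratureMatrix (U : Matrix ι ι ℂ))ᵀ := by simp only [Matrix.mul_assoc]
    _ = 1 := by
      rw [transpose_mul_quadratureMatrix, Matrix.mul_one, Matrix.mul_assoc _ signMatrix signMatrix,
        signMatrix_mul_self, Matrix.mul_one, quadratureMatrix_mul_transpose]

theorem squeezePart_eq_fromBlocks (U : Matrix ι ι ℂ) :
    squeezePart U = fromBlocks ((U * Uᵀ).map Complex.re) (-(U * Uᵀ).map Complex.im)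
      (-(U * Uᵀ).map Complex.im) (-(U * Uᵀ).map Complex.re) := by
  have hs : (signMatrix : Matrix (ι ⊕ ι) (ι ⊕ ι) ℝ) = fromBlocks 1 0 0 (-1) := by
    ext (x | x) (y | y) <;> by_cases h : x = y <;> simp [signMatrix, h]
  have h1 : (U * Uᵀ).map Complex.re = U.map Complex.re * (U.map Complex.re)ᵀ -
      U.map Complex.im * (U.map Complex.im)ᵀ := by
    ext x y; simp [mul_apply]
  have h2 : (U * Uᵀ).map Complex.im = U.map Complex.re * (U.map Complex.im)ᵀ +
      U.map Complex.im * (U.map Complex.re)ᵀ := by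
    ext x y; simp [mul_apply, Finset.sum_add_distrib]
  rw [squeezePart, quadratureMatrix, hs, fromBlocks_transpose, fromBlocks_multiply,
    fromBlocks_multiply, h1, h2, fromBlocks_inj]
  simp only [transpose_neg]
  refine ⟨?_, ?_, ?_, ?_⟩ <;> noncomm_ring

/-- Conjugation by the symplectic form `J` negates every matrix of this block shape and fixes the
identity. -/
theorem det_cosh_add_eq_det_cosh_sub {κ : Type*} [Fintype κ] [DecidableEq κ] (A B : Matrix κ κ ℝ)
    (c s : ℝ) :
    (c • (1 : Matrix (κ ⊕ κ) (κ ⊕ κ) ℝ) + s • fromBlocks A B B (-A)).det =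
      (c • (1 : Matrix (κ ⊕ κ) (κ ⊕ κ) ℝ) - s • fromBlocks A B B (-A)).det := by
  set J : Matrix (κ ⊕ κ) (κ ⊕ κ) ℝ := fromBlocks 0 1 (-1) 0
  set J' : Matrix (κ ⊕ κ) (κ ⊕ κ) ℝ := fromBlocks 0 (-1) 1 0
  have hJ : J' * J = 1 := by
    rw [fromBlocks_multiply, ← fromBlocks_one]; simp
  have e : c • (1 : Matrix (κ ⊕ κ) (κ ⊕ κ) ℝ) - s • fromBlocks A B B (-A) =
      J * (c • (1 : Matrix (κ ⊕ κ) (κ ⊕ κ) ℝ) + s • fromBlocks A B B (-A)) * J' := by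
    rw [Matrix.mul_add, Matrix.add_mul, Matrix.mul_smul, Matrix.smul_mul, Matrix.mul_one,
      mul_eq_one_comm.1 hJ, Matrix.mul_smul, Matrix.smul_mul, sub_eq_add_neg, ← smul_neg]
    congr 2
    rw [fromBlocks_multiply, fromBlocks_multiply, fromBlocks_neg]
    simp
  rw [e, det_mul, det_mul, mul_comm, ← mul_assoc, ← det_mul, hJ, det_one, one_mul]

/-- The projection on the quadratures of the modes in `Γ`. -/
noncomputable def modeProj (Γ : Finset ι) : Matrix (ι ⊕ ι) (ι ⊕ ι) ℝ :=
  diagonal (Sum.elim (fun x => if x ∈ Γ then 1 else 0) fun x => if x ∈ Γ then 1 else 0)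

/-- The inclusion of the quadratures of `Γ`. -/
abbrev modeIncl (Γ : Finset ι) : Γ ⊕ Γ → ι ⊕ ι := Sum.map Subtype.val Subtype.val

/-- The rows in `Γ` and columns outside of `Γ` of `squeezePart U`. -/
noncomputable def crossPart (Γ : Finset ι) (U : Matrix ι ι ℂ) : Matrix (Γ ⊕ Γ) (ι ⊕ ι) ℝ :=
  (modeProj Γ * squeezePart U * (1 - modeProj Γ)).submatrix (modeIncl Γ) id

theorem crossPart_eq (Γ : Finset ι) (U : Matrix ι ι ℂ) :
    crossPart Γ U = (squeezePart U).submatrix (modeIncl Γ) id * (1 - modeProj Γ) := by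
  have h : modeProj Γ * squeezePart U * (1 - modeProj Γ) =
    modeProj Γ * (squeezePart U * (1 - modeProj Γ)) := Matrix.mul_assoc _ _ _
  rw [crossPart, h]
  ext i j
  rw [submatrix_apply, modeProj, diagonal_mul]
  rcases i with i | i <;> simp [mul_apply, submatrix_apply]

theorem submatrix_mul_modeProj_mul (Γ : Finset ι) (M : Matrix (ι ⊕ ι) (ι ⊕ ι) ℝ) :
    M.submatrix (modeIncl Γ) id * modeProj Γ * (M.submatrix id (modeIncl Γ)) =
      M.submatrix (modeIncl Γ) (modeIncl Γ) * M.submatrix (modeIncl Γ) (modeIncl Γ) := by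
  ext i j
  rw [modeProj, Matrix.mul_assoc]
  simp only [mul_apply, submatrix_apply, Fintype.sum_sum_type, Sum.elim_inl,
    Sum.elim_inr, id, Sum.map_inl, Sum.map_inr, diagonal_apply, ite_mul, zero_mul, one_mul,
    Finset.sum_ite_eq, Finset.mem_univ, if_true, mul_ite, mul_zero]
  simp only [← Finset.sum_filter, Finset.filter_mem_eq_inter, Finset.univ_inter]
  rw [← Finset.sum_coe_sort Γ, ← Finset.sum_coe_sort Γ]

/-- With P the projection on Γ, restrict M (1 - P) M = M² - M P M to Γ and use M² = 1. -/
theorem crossPart_mul_transpose (Γ : Finset ι) (U : unitaryGroup ι ℂ) :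
    crossPart Γ (U : Matrix ι ι ℂ) * (crossPart Γ (U : Matrix ι ι ℂ))ᵀ =
      1 - (squeezePart (U : Matrix ι ι ℂ)).submatrix (modeIncl Γ) (modeIncl Γ) *
        (squeezePart (U : Matrix ι ι ℂ)).submatrix (modeIncl Γ) (modeIncl Γ) := by
  have hp : (1 - modeProj Γ : Matrix (ι ⊕ ι) (ι ⊕ ι) ℝ) * (1 - modeProj Γ)ᵀ = 1 - modeProj Γ := by
    rw [modeProj, ← diagonal_one, diagonal_sub, diagonal_transpose, diagonal_mul_diagonal]
    congr 1
    funext i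
    rcases i with i | i <;> by_cases h : i ∈ Γ <;> simp [h]
  rw [crossPart_eq, transpose_mul, transpose_submatrix, squeezePart_transpose]
  set M := squeezePart (U : Matrix ι ι ℂ) with hM
  rw [Matrix.mul_assoc, ← Matrix.mul_assoc (1 - modeProj Γ), hp, ← submatrix_mul_modeProj_mul,
    Matrix.sub_mul, Matrix.one_mul, Matrix.mul_sub, Matrix.mul_assoc]
  congr 1
  rw [← submatrix_mul _ _ _ _ _ Function.bijective_id, hM, squeezePart_mul_self]
  exact submatrix_one _ (Function.Injective.sumMap Subtype.val_injective Subtype.val_injective)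

theorem reducedCov_eq (s : ℝ) (Γ : Finset ι) (U : unitaryGroup ι ℂ) :
    reducedCov s Γ (U : Matrix ι ι ℂ) = Real.cosh (2 * s) • 1 + Real.sinh (2 * s) •
      (squeezePart (U : Matrix ι ι ℂ)).submatrix (modeIncl Γ) (modeIncl Γ) := by
  rw [reducedCov, evolvedCov_eq_add]
  have := submatrix_one (α := ℝ) (modeIncl Γ)
    (Function.Injective.sumMap Subtype.val_injective Subtype.val_injective)
  rw [← this]
  rfl

/-- Write c, s for the hyperbolic cosine and sine and M for the restricted matrix. One of the two
factors det(c + sM) may be replaced by det(c - sM), and (c + sM)(c - sM) = c² - s²M² = 1 + s²(1 -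
M²). -/
theorem det_reducedCov_sq (s : ℝ) (Γ : Finset ι) (U : unitaryGroup ι ℂ) :
    (reducedCov s Γ (U : Matrix ι ι ℂ)).det ^ 2 = (1 + Real.sinh (2 * s) ^ 2 •
      (crossPart Γ (U : Matrix ι ι ℂ) * (crossPart Γ (U : Matrix ι ι ℂ))ᵀ)).det := by
  rw [crossPart_mul_transpose, reducedCov_eq, sq]
  set M := (squeezePart (U : Matrix ι ι ℂ)).submatrix (modeIncl Γ) (modeIncl Γ) with hM
  have hblock : ∃ A B : Matrix Γ Γ ℝ, M = fromBlocks A B B (-A) := by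
    refine ⟨((U : Matrix ι ι ℂ) * (U : Matrix ι ι ℂ)ᵀ).map Complex.re |>.submatrix (↑) (↑),
      (-((U : Matrix ι ι ℂ) * (U : Matrix ι ι ℂ)ᵀ).map Complex.im).submatrix (↑) (↑), ?_⟩
    rw [hM, squeezePart_eq_fromBlocks]
    ext (i | i) (j | j) <;> rfl
  obtain ⟨A, B, hAB⟩ := hblock
  have h : (Real.cosh (2 * s) • 1 + Real.sinh (2 * s) • M).det =
      (Real.cosh (2 * s) • 1 - Real.sinh (2 * s) • M).det := by
    rw [hAB, det_cosh_add_eq_det_cosh_sub]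
  nth_rewrite 2 [h]
  rw [← det_mul]
  congr 1
  have e : (1 : Matrix (Γ ⊕ Γ) (Γ ⊕ Γ) ℝ) + Real.sinh (2 * s) ^ 2 • (1 - M * M) =
      Real.cosh (2 * s) ^ 2 • 1 - Real.sinh (2 * s) ^ 2 • (M * M) := by
    rw [Real.cosh_sq]
    module
  rw [e]
  simp only [Matrix.add_mul, Matrix.mul_sub, Matrix.smul_mul, Matrix.mul_smul, Matrix.one_mul,
    Matrix.mul_one]
  module

theorem one_sub_crossPart_mul_transpose (Γ : Finset ι) (U : unitaryGroup ι ℂ) :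
    1 - crossPart Γ (U : Matrix ι ι ℂ) * (crossPart Γ (U : Matrix ι ι ℂ))ᵀ =
      ((squeezePart (U : Matrix ι ι ℂ)).submatrix (modeIncl Γ) (modeIncl Γ))ᵀ *
        (squeezePart (U : Matrix ι ι ℂ)).submatrix (modeIncl Γ) (modeIncl Γ) := by
  rw [crossPart_mul_transpose, transpose_submatrix, squeezePart_transpose, sub_sub_cancel]

/-- Makes the logarithm, and hence the entropy, continuous in the gates; integrability rests on
this. -/
theorem det_reducedCov_ne_zero (s : ℝ) (Γ : Finset ι) (U : unitaryGroup ι ℂ) :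
    (reducedCov s Γ (U : Matrix ι ι ℂ)).det ≠ 0 := by
  have h := (log_det_one_add_smul_le _ (one_sub_crossPart_mul_transpose Γ U)
    (sq_nonneg (Real.sinh (2 * s)))).1
  rw [← det_reducedCov_sq] at h
  exact fun h0 => by simp [h0] at h

theorem renyi2_eq (s : ℝ) (Γ : Finset ι) (U : unitaryGroup ι ℂ) :
    renyi2 s Γ (U : Matrix ι ι ℂ) = 1 / 4 * Real.log (1 + Real.sinh (2 * s) ^ 2 •
      (crossPart Γ (U : Matrix ι ι ℂ) * (crossPart Γ (U : Matrix ι ι ℂ))ᵀ)).det := by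
  rw [← det_reducedCov_sq, Real.log_pow, renyi2]
  push_cast
  ring

theorem renyi2_le_rank (s : ℝ) (Γ : Finset ι) (U : unitaryGroup ι ℂ) :
    renyi2 s Γ (U : Matrix ι ι ℂ) ≤
      1 / 2 * (modeProj Γ * squeezePart (U : Matrix ι ι ℂ) * (1 - modeProj Γ)).rank *
        Real.log (Real.cosh (2 * s)) := by
  have h := (log_det_one_add_smul_le _ (one_sub_crossPart_mul_transpose Γ U)
    (sq_nonneg (Real.sinh (2 * s)))).2.1
  rw [add_comm 1 (Real.sinh (2 * s) ^ 2), ← Real.cosh_sq, Real.log_pow] at h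
  have hr : (crossPart Γ (U : Matrix ι ι ℂ)).rank ≤
      (modeProj Γ * squeezePart (U : Matrix ι ι ℂ) * (1 - modeProj Γ)).rank :=
    rank_submatrix_le _ _ _
  have hr' : ((crossPart Γ (U : Matrix ι ι ℂ)).rank : ℝ) ≤
      (modeProj Γ * squeezePart (U : Matrix ι ι ℂ) * (1 - modeProj Γ)).rank := by
    exact_mod_cast hr
  have hl : 0 ≤ Real.log (Real.cosh (2 * s)) := Real.log_nonneg (Real.one_le_cosh _)
  rw [renyi2_eq]
  push_cast at h
  nlinarith [mul_le_mul_of_nonneg_right hr' hl]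

/-- The real and the imaginary part of each entry of U Uᵀ occur in two of the four quadrature
blocks, whence the factor 2. -/
theorem trace_crossPart (Γ : Finset ι) (U : Matrix ι ι ℂ) :
    (crossPart Γ U * (crossPart Γ U)ᵀ).trace =
      2 * ∑ x ∈ Γ, ∑ y ∈ Γᶜ, ‖(U * Uᵀ) x y‖ ^ 2 := by
  have hN : ∀ i j, crossPart Γ U i j = squeezePart U (modeIncl Γ i) j *
      (Sum.elim (fun x => if x ∈ Γ then 0 else 1) (fun x => if x ∈ Γ then 0 else 1) j) := by
    intro i j
    rw [crossPart_eq, modeProj, ← diagonal_one, diagonal_sub, mul_diagonal]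
    rcases j with j | j <;> by_cases h : j ∈ Γ <;> simp [h]
  simp only [trace, diag_apply, mul_apply, transpose_apply, hN, Fintype.sum_sum_type, Sum.elim_inl,
    Sum.elim_inr, Sum.map_inl, Sum.map_inr, squeezePart_eq_fromBlocks, fromBlocks_apply₁₁,
    fromBlocks_apply₁₂, fromBlocks_apply₂₁, fromBlocks_apply₂₂, map_apply, Matrix.neg_apply]
  rw [← Finset.sum_add_distrib, Finset.mul_sum, ← Finset.sum_coe_sort Γ]
  refine Finset.sum_congr rfl fun x _ => ?_
  rw [← Finset.sum_add_distrib, ← Finset.sum_add_distrib, ← Finset.sum_add_distrib,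
    Finset.mul_sum, ← Finset.sum_subset (Finset.subset_univ Γᶜ)]
  · refine Finset.sum_congr rfl fun y hy => ?_
    rw [if_neg (Finset.mem_compl.1 hy), ← Complex.normSq_eq_norm_sq, Complex.normSq_apply]
    ring
  · intro y _ hy
    simp at hy
    simp [hy]

theorem renyi2_le_sum (s : ℝ) (Γ : Finset ι) (U : unitaryGroup ι ℂ) :
    renyi2 s Γ (U : Matrix ι ι ℂ) ≤ 1 / 2 * Real.sinh (2 * s) ^ 2 *
      ∑ x ∈ Γ, ∑ y ∈ Γᶜ, ‖((U : Matrix ι ι ℂ) * (U : Matrix ι ι ℂ)ᵀ) x y‖ ^ 2 := by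
  have h := (log_det_one_add_smul_le _ (one_sub_crossPart_mul_transpose Γ U)
    (sq_nonneg (Real.sinh (2 * s)))).2.2
  rw [trace_crossPart] at h
  rw [renyi2_eq]
  linarith

end Gaussian

section Circuit

variable {D m d : ℕ}

/-! ### The circuit as a product of layers -/

/-- The mode in the same block of a layer (the mode itself if its block is a singleton). -/
def modePartner (l : Fin D × Bool) (x : Modes D m) : Modes D m :=
  Function.update x l.1 (partner l.2 (x l.1))

theorem blockLabel_modePartner (l : Fin D × Bool) (x : Modes D m) :
    blockLabel l (modePartner l x) = blockLabel l x := by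
  funext i
  unfold blockLabel modePartner
  by_cases h : i = l.1
  · subst h; simpa using partner_label l.2 (x l.1)
  · simp [h]

theorem modePartner_modePartner (l : Fin D × Bool) (x : Modes D m) :
    modePartner l (modePartner l x) = x := by
  simp [modePartner, partner_partner]

theorem eq_or_eq_modePartner {l : Fin D × Bool} {x y : Modes D m}
    (h : blockLabel l y = blockLabel l x) : y = x ∨ y = modePartner l x := by
  have h1 : ∀ i, i ≠ l.1 → y i = x i := by
    intro i hi
    have := congrFun h i
    simp only [blockLabel, hi, if_false] at this
    exact Fin.ext this
  have h2 := congrFun h l.1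
  simp only [blockLabel, if_true] at h2
  rcases eq_or_eq_partner l.2 h2 with h3 | h3
  · left
    funext i
    by_cases hi : i = l.1
    · rw [hi, h3]
    · exact h1 i hi
  · right
    funext i
    by_cases hi : i = l.1
    · subst hi; simp [modePartner, h3]
    · simp [modePartner, hi, h1 i hi]

theorem layer_apply {l : Fin D × Bool} (u : ∀ c : Blocks D m l, unitaryGroup (BlockModes c) ℂ)
    (c : Blocks D m l) (x y : BlockModes c) : layer l u x.1 y.1 = (u c).1 x y := by
  obtain ⟨c, hc⟩ := c
  obtain ⟨x, hx⟩ := x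
  obtain ⟨y, hy⟩ := y
  dsimp only at hx hy
  subst hx
  simp [layer, hy]

theorem layer_apply_of_ne {l : Fin D × Bool}
    (u : ∀ c : Blocks D m l, unitaryGroup (BlockModes c) ℂ) {x y : Modes D m}
    (h : blockLabel l y ≠ blockLabel l x) : layer l u x y = 0 := by
  simp [layer, h]

theorem sum_eq_sum_block {l : Fin D × Bool} (c : Blocks D m l) {f : Modes D m → ℂ}
    (hf : ∀ y, blockLabel l y ≠ c.1 → f y = 0) : ∑ y, f y = ∑ y : BlockModes c, f y.1 := by
  rw [← Finset.sum_subtype (Finset.univ.filter fun y => blockLabel l y = c.1) (by simp) f,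
    Finset.sum_filter]
  refine Finset.sum_congr rfl fun y _ => ?_
  split_ifs with h
  · rfl
  · exact hf y h

theorem layer_mem_unitaryGroup {l : Fin D × Bool}
    (u : ∀ c : Blocks D m l, unitaryGroup (BlockModes c) ℂ) :
    layer l u ∈ unitaryGroup (Modes D m) ℂ := by
  rw [mem_unitaryGroup_iff]
  ext x z
  simp only [mul_apply, star_apply]
  by_cases h : blockLabel l z = blockLabel l x
  · let c : Blocks D m l := ⟨blockLabel l x, x, rfl⟩
    rw [sum_eq_sum_block c]
    · have hu := congrFun (congrFun (mem_unitaryGroup_iff.1 (u c).2) ⟨x, rfl⟩) ⟨z, h⟩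
      simp only [mul_apply, star_apply] at hu
      have e : (1 : Matrix (BlockModes c) (BlockModes c) ℂ) ⟨x, rfl⟩ ⟨z, h⟩ =
          (1 : Matrix (Modes D m) (Modes D m) ℂ) x z := by
        simp [one_apply]
      rw [← e, ← hu]
      exact Finset.sum_congr rfl fun y _ => by
        rw [← layer_apply u c, ← layer_apply u c]
    · intro y hy
      rw [layer_apply_of_ne u hy, zero_mul]
  · rw [one_apply_ne (fun hxz => h (by rw [hxz]))]
    refine Finset.sum_eq_zero fun y _ => ?_
    by_cases hy : blockLabel l y = blockLabel l x
    · rw [layer_apply_of_ne u (x := z) (by rw [hy]; exact fun h' => h h'.symm), star_zero, mul_zero]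
    · rw [layer_apply_of_ne u hy, zero_mul]

/-- Every unitary matrix which is block diagonal with respect to the blocks of a layer is the
matrix of this layer for some choice of gates. -/
theorem exists_layer_eq {l : Fin D × Bool} {V : Matrix (Modes D m) (Modes D m) ℂ}
    (hV : V ∈ unitaryGroup (Modes D m) ℂ)
    (hl : ∀ x y, blockLabel l y ≠ blockLabel l x → V x y = 0) :
    ∃ u : ∀ c : Blocks D m l, unitaryGroup (BlockModes c) ℂ, layer l u = V := by
  refine ⟨fun c => ⟨V.submatrix Subtype.val Subtype.val, ?_⟩, ?_⟩
  · rw [mem_unitaryGroup_iff]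
    ext x z
    have h := congrFun (congrFun (mem_unitaryGroup_iff.1 hV) x.1) z.1
    simp only [mul_apply, star_apply] at h
    rw [sum_eq_sum_block c (fun y hy => by rw [hl _ _ (by rwa [x.2]), zero_mul])] at h
    simp only [mul_apply, star_apply, submatrix_apply]
    rw [h]
    simp [one_apply, Subtype.ext_iff]
  · ext x y
    by_cases h : blockLabel l y = blockLabel l x
    · simp [layer, h]
    · rw [layer_apply_of_ne _ h, hl x y h]

theorem layer_mul {l : Fin D × Bool} (u v : ∀ c : Blocks D m l, unitaryGroup (BlockModes c) ℂ) :
    layer l (fun c => u c * v c) = layer l u * layer l v := by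
  ext x z
  rw [mul_apply]
  by_cases h : blockLabel l z = blockLabel l x
  · let c : Blocks D m l := ⟨blockLabel l x, x, rfl⟩
    rw [sum_eq_sum_block c (fun y hy => by rw [layer_apply_of_ne u hy, zero_mul])]
    have e := layer_apply (fun c => u c * v c) c ⟨x, rfl⟩ ⟨z, h⟩
    rw [e]
    refine Eq.trans (mul_apply (M := (u c).1) (N := (v c).1)) ?_
    exact Finset.sum_congr rfl fun y _ => by rw [← layer_apply u c, ← layer_apply v c]
  · rw [layer_apply_of_ne _ h]
    refine (Finset.sum_eq_zero fun y _ => ?_).symm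
    by_cases hy : blockLabel l y = blockLabel l x
    · rw [layer_apply_of_ne v (by rw [hy]; exact h), mul_zero]
    · rw [layer_apply_of_ne u hy, zero_mul]

/-- The matrix of the layer at a given position of the circuit. -/
noncomputable def layerAt (u : Gates D m d) (p : Fin d × (Fin D × Bool)) :
    Matrix (Modes D m) (Modes D m) ℂ :=
  layer p.2 fun c => u ⟨p, c⟩

/-- The product of the layers at a list of positions, the last one being applied first. -/
noncomputable def layerProd (u : Gates D m d) (ps : List (Fin d × (Fin D × Bool))) :
    Matrix (Modes D m) (Modes D m) ℂ :=
  (ps.map (layerAt u)).prod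

/-- The positions of the layers of the circuit, from the last one applied to the first one. -/
def positions (ord : Fin d → (Fin (2 * D) ≃ Fin D × Bool)) : List (Fin d × (Fin D × Bool)) :=
  ((List.ofFn fun i => (List.ofFn fun t => (i, ord i t)).reverse).reverse).flatten

theorem circuit_eq_layerProd (ord : Fin d → (Fin (2 * D) ≃ Fin D × Bool)) (u : Gates D m d) :
    circuit ord u = layerProd u (positions ord) := by
  rw [layerProd, positions, List.map_flatten, List.prod_flatten, circuit]
  congr 1
  simp only [List.map_reverse, List.map_ofFn]
  congr 2
  funext i
  simp only [Function.comp_apply, List.map_reverse, List.map_ofFn]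
  rfl

/-- Each layer occurs once: face areas are not counted repeatedly, and a change of one layer's gates
leaves the other factors alone. -/
theorem nodup_positions (ord : Fin d → (Fin (2 * D) ≃ Fin D × Bool)) : (positions ord).Nodup := by
  rw [positions, List.nodup_flatten]
  constructor
  · intro l hl
    rw [List.mem_reverse, List.mem_ofFn] at hl
    obtain ⟨i, rfl⟩ := hl
    rw [List.nodup_reverse, List.nodup_ofFn]
    intro a b hab
    exact (ord i).injective (Prod.ext_iff.1 hab).2
  · rw [List.pairwise_reverse, List.pairwise_ofFn]
    intro i j hij
    rw [List.disjoint_left]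
    intro p hp hp'
    rw [List.mem_reverse, List.mem_ofFn] at hp hp'
    obtain ⟨a, rfl⟩ := hp
    obtain ⟨b, hb⟩ := hp'
    have e : i = j := (Prod.ext_iff.1 hb).1
    exact hij.ne e

theorem layerProd_mem_unitaryGroup (u : Gates D m d) (ps : List (Fin d × (Fin D × Bool))) :
    layerProd u ps ∈ unitaryGroup (Modes D m) ℂ := by
  refine Submonoid.list_prod_mem _ fun V hV => ?_
  obtain ⟨p, -, rfl⟩ := List.mem_map.1 hV
  exact layer_mem_unitaryGroup _

theorem layerProd_cons (u : Gates D m d) (p : Fin d × (Fin D × Bool))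
    (ps : List (Fin d × (Fin D × Bool))) :
    layerProd u (p :: ps) = layerAt u p * layerProd u ps := by
  simp [layerProd]

/-! ### The worst-case bound -/

theorem matrix_rank_add_le {κ ν : Type*} [Fintype ν] (A B : Matrix κ ν ℝ) [Finite κ] :
    (A + B).rank ≤ A.rank + B.rank := by
  rw [Matrix.rank, Matrix.rank, Matrix.rank, mulVecLin_add]
  exact (Submodule.finrank_mono (LinearMap.range_add_le _ _)).trans
    (Submodule.finrank_add_le_finrank_add_finrank _ _)

/-- Insert P + (1 - P) between the factors: the crossing from P to 1 - P takes place either in B or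
in A. -/
theorem rank_mul_cross_le {κ : Type*} [Fintype κ] [DecidableEq κ] (P A B : Matrix κ κ ℝ) :
    (P * (A * B) * (1 - P)).rank ≤ (P * A * (1 - P)).rank + (P * B * (1 - P)).rank := by
  have e : P * (A * B) * (1 - P) = P * A * (P * B * (1 - P)) + P * A * (1 - P) * (B * (1 - P)) := by
    noncomm_ring
  rw [e, add_comm]
  exact (matrix_rank_add_le _ _).trans (add_le_add (rank_mul_le_left _ _) (rank_mul_le_right _ _))

theorem rank_le_card_rows {κ ν : Type*} [Fintype κ] [DecidableEq κ] [Fintype ν] (A : Matrix κ ν ℝ)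
    (R : Finset κ) (h : ∀ i j, A i j ≠ 0 → i ∈ R) : A.rank ≤ R.card := by
  have e : A = diagonal (fun i => if i ∈ R then (1 : ℝ) else 0) * A := by
    ext i j
    rw [diagonal_mul]
    by_cases hi : i ∈ R
    · simp [hi]
    · have : A i j = 0 := by by_contra h'; exact hi (h i j h')
      simp [hi, this]
  rw [e]
  refine (rank_mul_le_left _ _).trans ?_
  classical
  rw [rank_diagonal, Fintype.card_subtype]
  refine Finset.card_le_card fun i hi => ?_
  by_contra h'
  simp [h'] at hi

theorem modeProj_mul_mul_apply {ι : Type*} [Fintype ι] [DecidableEq ι] (Γ : Finset ι)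
    (A : Matrix (ι ⊕ ι) (ι ⊕ ι) ℝ) (i j : ι ⊕ ι) :
    (modeProj Γ * A * (1 - modeProj Γ)) i j =
      if Sum.elim id id i ∈ Γ ∧ Sum.elim id id j ∉ Γ then A i j else 0 := by
  rw [modeProj, ← diagonal_one, diagonal_sub, mul_diagonal, diagonal_mul]
  rcases i with i | i <;> rcases j with j | j <;> by_cases hi : i ∈ Γ <;> by_cases hj : j ∈ Γ <;>
    simp [hi, hj]

/-- The number of modes on a face of the box, if this face is not on the boundary of the grid. -/
def faceArea (m : ℕ) (k : Fin D → ℕ) (j : Fin D) : ℕ :=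
  (if k j < m then 1 else 0) * ∏ l ∈ Finset.univ.erase j, k l

theorem card_lt_le (m k : ℕ) : (Finset.univ.filter fun a : Fin m => (a : ℕ) < k).card ≤ k := by
  have : (Finset.univ.filter fun a : Fin m => (a : ℕ) < k).card =
      ((Finset.univ.filter fun a : Fin m => (a : ℕ) < k).map Fin.valEmbedding).card := by simp
  rw [this]
  calc _ ≤ (Finset.range k).card := Finset.card_le_card fun a ha => by
        simp at ha ⊢; obtain ⟨b, hb, rfl⟩ := ha; exact hb
    _ = k := Finset.card_range k

theorem card_face_le (m : ℕ) (k : Fin D → ℕ) (j : Fin D) :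
    ((box m k).filter fun x => (x j : ℕ) + 1 = k j).card ≤ ∏ l ∈ Finset.univ.erase j, k l := by
  set t : Fin D → Finset (Fin m) := fun i => if i = j then
    Finset.univ.filter (fun a : Fin m => (a : ℕ) + 1 = k j) else
    Finset.univ.filter (fun a : Fin m => (a : ℕ) < k i) with ht
  calc ((box m k).filter fun x => (x j : ℕ) + 1 = k j).card
      ≤ (Fintype.piFinset t).card := by
        refine Finset.card_le_card fun x hx => ?_
        simp only [box, Finset.mem_filter, Finset.mem_univ, true_and] at hx
        rw [Fintype.mem_piFinset]
        intro i
        simp only [ht]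
        split_ifs with h
        · subst h; simpa using hx.2
        · simpa using hx.1 i
    _ = (t j).card * ∏ i ∈ Finset.univ.erase j, (t i).card := by
        rw [Fintype.card_piFinset, Finset.mul_prod_erase _ (fun i => (t i).card) (Finset.mem_univ j)]
    _ ≤ 1 * ∏ l ∈ Finset.univ.erase j, k l := by
        refine Nat.mul_le_mul ?_ (Finset.prod_le_prod' fun i hi => ?_)
        · rw [Finset.card_le_one]
          intro a ha b hb
          simp only [ht, if_true, Finset.mem_filter, Finset.mem_univ, true_and] at ha hb
          exact Fin.ext (by omega)
        · simp only [ht, Finset.ne_of_mem_erase hi, if_false]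
          exact card_lt_le m (k i)
    _ = _ := one_mul _

theorem crossing_modes {l : Fin D × Bool} {k : Fin D → ℕ} {x y : Modes D m} (hx : x ∈ box m k)
    (hy : y ∉ box m k) (h : blockLabel l y = blockLabel l x) :
    (x l.1 : ℕ) + 1 = k l.1 ∧ k l.1 < m := by
  simp only [box, Finset.mem_filter, Finset.mem_univ, true_and] at hx hy
  push Not at hy
  obtain ⟨i, hi⟩ := hy
  have hxi := hx i
  have hyi := (y i).2
  have hl := congrFun h i
  simp only [blockLabel] at hl
  by_cases hil : i = l.1
  · subst hil
    simp only [if_true] at hl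
    omega
  · simp only [hil, if_false] at hl
    omega

/-- A nonzero row belongs to a mode whose block straddles the boundary, so the mode lies on the
face. Position and momentum account for the factor 2. -/
theorem rank_cross_le_faceArea (l : Fin D × Bool) (k : Fin D → ℕ)
    (A : Matrix (Modes D m ⊕ Modes D m) (Modes D m ⊕ Modes D m) ℝ)
    (hA : ∀ i j, blockLabel l (Sum.elim id id j) ≠ blockLabel l (Sum.elim id id i) → A i j = 0) :
    (modeProj (box m k) * A * (1 - modeProj (box m k))).rank ≤ 2 * faceArea m k l.1 := by
  have key : ∀ i j, (modeProj (box m k) * A * (1 - modeProj (box m k))) i j ≠ 0 →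
      Sum.elim id id i ∈ (box m k).filter (fun x => (x l.1 : ℕ) + 1 = k l.1) ∧ k l.1 < m := by
    intro i j hij
    rw [modeProj_mul_mul_apply] at hij
    split_ifs at hij with h
    · have hlab : blockLabel l (Sum.elim id id j) = blockLabel l (Sum.elim id id i) := by
        by_contra h'; exact hij (hA i j h')
      have := crossing_modes h.1 h.2 hlab
      exact ⟨Finset.mem_filter.2 ⟨h.1, this.1⟩, this.2⟩
    · exact absurd rfl hij
  by_cases hk : k l.1 < m
  · set R := (box m k).filter (fun x => (x l.1 : ℕ) + 1 = k l.1) with hR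
    have := rank_le_card_rows _ (R.disjSum R) (fun i j hij => by
      have := (key i j hij).1
      rcases i with i | i
      · exact Finset.inl_mem_disjSum.2 this
      · exact Finset.inr_mem_disjSum.2 this)
    refine this.trans ?_
    rw [Finset.card_disjSum, faceArea, if_pos hk, one_mul]
    have := card_face_le m k l.1
    rw [← hR] at this
    omega
  · refine (rank_le_card_rows _ ∅ fun i j hij => absurd (key i j hij).2 hk).trans ?_
    simp

theorem quadratureMatrix_layerAt_apply (u : Gates D m d) (p : Fin d × (Fin D × Bool))
    (i j : Modes D m ⊕ Modes D m)
    (h : blockLabel p.2 (Sum.elim id id j) ≠ blockLabel p.2 (Sum.elim id id i)) :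
    quadratureMatrix (layerAt u p) i j = 0 := by
  have h0 : layerAt u p (Sum.elim id id i) (Sum.elim id id j) = 0 := layer_apply_of_ne _ h
  rcases i with i | i <;> rcases j with j | j <;> simp at h0 <;> simp [quadratureMatrix, h0]

/-- The transpose is needed because `squeezePart` contains both Q and Qᵀ; it obeys the same bound
since sharing a block is a symmetric relation. -/
theorem rank_cross_layerProd_le (u : Gates D m d) (k : Fin D → ℕ)
    (ps : List (Fin d × (Fin D × Bool))) :
    (modeProj (box m k) * quadratureMatrix (layerProd u ps) * (1 - modeProj (box m k))).rank ≤
      (ps.map fun p => 2 * faceArea m k p.2.1).sum ∧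
    (modeProj (box m k) * (quadratureMatrix (layerProd u ps))ᵀ * (1 - modeProj (box m k))).rank ≤
      (ps.map fun p => 2 * faceArea m k p.2.1).sum := by
  have hP : modeProj (box m k) * (1 - modeProj (box m k)) = 0 := by
    ext i j
    have := modeProj_mul_mul_apply (box m k) 1 i j
    rw [Matrix.mul_one] at this
    rw [this]
    split_ifs with h
    · rw [one_apply_ne]
      · rfl
      · rintro rfl; exact h.2 h.1
    · rfl
  induction ps with
  | nil => simp [layerProd, quadratureMatrix_one, hP]
  | cons p ps ih =>
    rw [layerProd_cons, quadratureMatrix_mul, transpose_mul, List.map_cons, List.sum_cons]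
    have h1 := rank_cross_le_faceArea p.2 k (quadratureMatrix (layerAt u p))
      (quadratureMatrix_layerAt_apply u p)
    have h2 := rank_cross_le_faceArea p.2 k (quadratureMatrix (layerAt u p))ᵀ
      (fun i j h => quadratureMatrix_layerAt_apply u p j i h.symm)
    refine ⟨(rank_mul_cross_le _ _ _).trans (add_le_add h1 ih.1), (rank_mul_cross_le _ _ _).trans ?_⟩
    rw [add_comm]
    exact add_le_add h2 ih.2

theorem sum_map_le_of_nodup {α : Type*} [Fintype α] [DecidableEq α] (f : α → ℕ) {l : List α}
    (h : l.Nodup) : (l.map f).sum ≤ ∑ a, f a := by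
  rw [← List.sum_toFinset f h]
  exact Finset.sum_le_sum_of_subset (Finset.subset_univ _)

theorem renyi2_circuit_le (k : Fin D → ℕ) (s : ℝ) (ord : Fin d → (Fin (2 * D) ≃ Fin D × Bool))
    (u : Gates D m d) :
    renyi2 s (box m k) (circuit ord u) ≤
      4 * d * boundaryArea m k * Real.log (Real.cosh (2 * s)) := by
  rw [circuit_eq_layerProd]
  set U : unitaryGroup (Modes D m) ℂ := ⟨_, layerProd_mem_unitaryGroup u (positions ord)⟩ with hU
  refine (renyi2_le_rank s (box m k) U).trans ?_
  -- The initial product state is diagonal and couples nothing across the boundary.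
  have hsign : (modeProj (box m k) * signMatrix * (1 - modeProj (box m k))).rank ≤ 0 := by
    have := rank_le_card_rows (modeProj (box m k) * signMatrix * (1 - modeProj (box m k))) ∅
      (fun i j hij => by
        rw [modeProj_mul_mul_apply] at hij
        split_ifs at hij with h
        · rw [signMatrix, diagonal_apply_ne _ (by rintro rfl; exact h.2 h.1)] at hij
          exact absurd rfl hij
        · exact absurd rfl hij)
    simpa using this
  have h1 := rank_cross_layerProd_le u k (positions ord)
  have h2 : (modeProj (box m k) * squeezePart (U : Matrix (Modes D m) (Modes D m) ℂ) *
      (1 - modeProj (box m k))).rank ≤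
      2 * ((positions ord).map fun p => 2 * faceArea m k p.2.1).sum := by
    rw [squeezePart]
    have := rank_mul_cross_le (modeProj (box m k)) (quadratureMatrix (U : Matrix _ _ ℂ) * signMatrix)
      (quadratureMatrix (U : Matrix _ _ ℂ))ᵀ
    have := rank_mul_cross_le (modeProj (box m k)) (quadratureMatrix (U : Matrix _ _ ℂ)) signMatrix
    have h3 := h1.1
    have h4 := h1.2
    simp only [hU] at *
    omega
  have h3 := sum_map_le_of_nodup (fun p : Fin d × (Fin D × Bool) => 2 * faceArea m k p.2.1)
    (nodup_positions ord)
  -- The 4 is two sides per direction times two quadratures. The further doubling from Q and Qᵀ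
  -- cancels the 1/2 of `renyi2_le_rank`.
  have h4 : ∑ p : Fin d × (Fin D × Bool), 2 * faceArea m k p.2.1 = 4 * d * boundaryArea m k := by
    rw [Fintype.sum_prod_type]
    simp only [Fintype.sum_prod_type, Finset.sum_const, Finset.card_univ, Fintype.card_bool,
      Fintype.card_fin, smul_eq_mul]
    rw [← Finset.mul_sum, ← Finset.mul_sum]
    simp only [boundaryArea, faceArea]
    ring
  have h5 : (modeProj (box m k) * squeezePart (U : Matrix (Modes D m) (Modes D m) ℂ) *
      (1 - modeProj (box m k))).rank ≤ 2 * (4 * d * boundaryArea m k) := by omega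
  have h6 : ((modeProj (box m k) * squeezePart (U : Matrix (Modes D m) (Modes D m) ℂ) *
      (1 - modeProj (box m k))).rank : ℝ) ≤ 2 * (4 * d * boundaryArea m k) := by exact_mod_cast h5
  have hl : 0 ≤ Real.log (Real.cosh (2 * s)) := Real.log_nonneg (Real.one_le_cosh _)
  exact mul_le_mul_of_nonneg_right (by linarith) hl

/-! ### Haar measure on the gates -/

instance {ι : Type*} [Fintype ι] [DecidableEq ι] :
    SecondCountableTopology (unitaryGroup ι ℂ) :=
  haveI : SecondCountableTopology (Matrix ι ι ℂ) :=
    inferInstanceAs (SecondCountableTopology (ι → ι → ℂ))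
  TopologicalSpace.Subtype.secondCountableTopology _

instance {ι : Type*} [Fintype ι] [DecidableEq ι] : CompactSpace (unitaryGroup ι ℂ) := by
  refine isCompact_iff_compactSpace.1 ?_
  have hc : IsCompact (Set.pi Set.univ fun _ : ι => Set.pi Set.univ fun _ : ι =>
      Metric.closedBall (0 : ℂ) 1) :=
    isCompact_univ_pi fun _ => isCompact_univ_pi fun _ => isCompact_closedBall _ _
  refine IsCompact.of_isClosed_subset (X := Matrix ι ι ℂ) hc isClosed_unitary fun U hU => ?_
  intro i _ j _
  simpa using entry_norm_bound_of_unitary hU i j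

/-- A right translate is again a Haar probability measure, so uniqueness identifies it with `μ`. -/
theorem isMulRightInvariant_of_compactSpace {G : Type*} [TopologicalSpace G] [Group G]
    [IsTopologicalGroup G] [CompactSpace G] [MeasurableSpace G] [BorelSpace G] (μ : Measure G)
    [IsProbabilityMeasure μ] [μ.IsHaarMeasure] : μ.IsMulRightInvariant := by
  refine ⟨fun g => ?_⟩
  have : IsProbabilityMeasure (μ.map (· * g)) :=
    Measure.isProbabilityMeasure_map (measurable_mul_const g).aemeasurable
  have : (μ.map (· * g)).IsHaarMeasure :=
    { toIsFiniteMeasureOnCompacts := inferInstance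
      toIsMulLeftInvariant := inferInstance
      toIsOpenPosMeasure :=
        (continuous_mul_const g).isOpenPosMeasure_map (mul_right_surjective g) }
  exact Measure.isHaarMeasure_eq_of_isProbabilityMeasure _ _

/-- Gates realizing V at `p` and the identity elsewhere turn invariance of the Haar measure into the
freedom to insert V on either side of a single layer. -/
theorem exists_gates_mul (p : Fin d × (Fin D × Bool)) {V : Matrix (Modes D m) (Modes D m) ℂ}
    (hV : V ∈ unitaryGroup (Modes D m) ℂ)
    (hl : ∀ x y, blockLabel p.2 y ≠ blockLabel p.2 x → V x y = 0) :
    ∃ g : Gates D m d, ∀ u : Gates D m d,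
      (layerAt (g * u) p = V * layerAt u p ∧ ∀ q, q ≠ p → layerAt (g * u) q = layerAt u q) ∧
      (layerAt (u * g) p = layerAt u p * V ∧ ∀ q, q ≠ p → layerAt (u * g) q = layerAt u q) := by
  have h : ∀ q : Fin d × (Fin D × Bool),
      ∃ u : ∀ c : Blocks D m q.2, unitaryGroup (BlockModes c) ℂ,
        layer q.2 u = if q = p then V else 1 := by
    intro q
    apply exists_layer_eq
    · split_ifs
      · exact hV
      · exact one_mem _
    · intro x y hxy
      split_ifs with hq
      · subst hq; exact hl x y hxy
      · exact one_apply_ne fun h => hxy (by rw [h])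
  choose w hw using h
  let g : Gates D m d := fun a => w a.1 a.2
  refine ⟨g, fun u => ?_⟩
  have e1 : ∀ q, layerAt (g * u) q = (if q = p then V else 1) * layerAt u q :=
    fun q => by rw [← hw q]; exact layer_mul _ _
  have e2 : ∀ q, layerAt (u * g) q = layerAt u q * (if q = p then V else 1) :=
    fun q => by rw [← hw q]; exact layer_mul _ _
  refine ⟨⟨?_, fun q hq => ?_⟩, ⟨?_, fun q hq => ?_⟩⟩
  · rw [e1, if_pos rfl]
  · rw [e1, if_neg hq, Matrix.one_mul]
  · rw [e2, if_pos rfl]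
  · rw [e2, if_neg hq, Matrix.mul_one]

theorem layerProd_congr {u u' : Gates D m d} {ps : List (Fin d × (Fin D × Bool))}
    (h : ∀ q ∈ ps, layerAt u q = layerAt u' q) : layerProd u ps = layerProd u' ps := by
  rw [layerProd, layerProd, List.map_congr_left h]

theorem continuous_layerAt (p : Fin d × (Fin D × Bool)) :
    Continuous fun u : Gates D m d => layerAt u p := by
  refine continuous_matrix fun x y => ?_
  simp only [layerAt, layer]
  split_ifs with h
  · exact (continuous_subtype_val.comp (continuous_apply _)).matrix_elem _ _
  · exact continuous_const

theorem continuous_layerProd (ps : List (Fin d × (Fin D × Bool))) :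
    Continuous fun u : Gates D m d => layerProd u ps := by
  induction ps with
  | nil => simpa [layerProd] using continuous_const
  | cons p ps ih =>
    simp only [layerProd_cons]
    exact (continuous_layerAt p).matrix_mul ih

/-! ### Second moments of the random circuit -/

/-- The expectation of the function `f` of the mode in the (unnormalized) state `v`. -/
noncomputable def weight (f : Modes D m → ℝ) (v : Modes D m → ℂ) : ℝ := ∑ x, f x * ‖v x‖ ^ 2

theorem weight_mono {f g : Modes D m → ℝ} (h : ∀ x, f x ≤ g x) (v : Modes D m → ℂ) :
    weight f v ≤ weight g v :=
  Finset.sum_le_sum fun x _ => mul_le_mul_of_nonneg_right (h x) (sq_nonneg _)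

theorem weight_nonneg {f : Modes D m → ℝ} (h : ∀ x, 0 ≤ f x) (v : Modes D m → ℂ) :
    0 ≤ weight f v :=
  Finset.sum_nonneg fun x _ => mul_nonneg (h x) (sq_nonneg _)

theorem weight_single (f : Modes D m → ℝ) (z : Modes D m) :
    weight f (Pi.single z 1) = f z := by
  rw [weight, Finset.sum_eq_single z]
  · simp
  · intro x _ hx; simp [hx]
  · simp

theorem ofReal_weight (f : Modes D m → ℝ) (v : Modes D m → ℂ) :
    (weight f v : ℂ) = star v ⬝ᵥ (diagonal (fun x => (f x : ℂ)) *ᵥ v) := by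
  simp only [weight, dotProduct, mulVec_diagonal, Pi.star_apply]
  push_cast
  refine Finset.sum_congr rfl fun x _ => ?_
  rw [← Complex.conj_mul']
  simp only [Complex.star_def]
  ring

/-- A function constant on blocks gives a diagonal matrix commuting with the unitary layer. -/
theorem weight_layer_mulVec {l : Fin D × Bool}
    (u : ∀ c : Blocks D m l, unitaryGroup (BlockModes c) ℂ) {f : Modes D m → ℝ}
    (hf : ∀ x, f (modePartner l x) = f x) (v : Modes D m → ℂ) :
    weight f (layer l u *ᵥ v) = weight f v := by
  have hcomm : diagonal (fun x => (f x : ℂ)) * layer l u =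
      layer l u * diagonal (fun x => (f x : ℂ)) := by
    ext x y
    rw [diagonal_mul, mul_diagonal]
    by_cases h : blockLabel l y = blockLabel l x
    · have : f y = f x := by
        rcases eq_or_eq_modePartner h with rfl | rfl
        · rfl
        · exact hf x
      rw [this, mul_comm]
    · rw [layer_apply_of_ne u h]; simp
  have hu := mem_unitaryGroup_iff'.1 (layer_mem_unitaryGroup u)
  rw [← Complex.ofReal_inj, ofReal_weight, ofReal_weight, star_mulVec, mulVec_mulVec, hcomm,
    ← mulVec_mulVec, dotProduct_mulVec, vecMul_vecMul]
  rw [star_eq_conjTranspose] at hu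
  rw [hu, vecMul_one]

/-- The average of a function over the blocks of a layer. -/
noncomputable def modeAvg (l : Fin D × Bool) (f : Modes D m → ℝ) (x : Modes D m) : ℝ :=
  (f x + f (modePartner l x)) / 2

theorem modeAvg_modePartner (l : Fin D × Bool) (f : Modes D m → ℝ) (x : Modes D m) :
    modeAvg l f (modePartner l x) = modeAvg l f x := by
  rw [modeAvg, modePartner_modePartner, add_comm, modeAvg]

theorem modeAvg_eq_self {l : Fin D × Bool} {f : Modes D m → ℝ}
    (hf : ∀ x, f (modePartner l x) = f x) : modeAvg l f = f := by
  funext x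
  rw [modeAvg, hf]
  ring

theorem sum_comp_modePartner (l : Fin D × Bool) (f : Modes D m → ℝ) :
    ∑ x, f (modePartner l x) = ∑ x, f x :=
  Equiv.sum_comp (Function.Involutive.toPerm _ (modePartner_modePartner l)) f

/-- The unitary exchanging the two modes of each block of a layer. -/
noncomputable def swapMatrix (l : Fin D × Bool) : Matrix (Modes D m) (Modes D m) ℂ :=
  fun x y => if y = modePartner l x then 1 else 0

theorem swapMatrix_mulVec (l : Fin D × Bool) (v : Modes D m → ℂ) (x : Modes D m) :
    (swapMatrix l *ᵥ v) x = v (modePartner l x) := by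
  simp [swapMatrix, mulVec, dotProduct]

theorem swapMatrix_mem_unitaryGroup (l : Fin D × Bool) :
    (swapMatrix l : Matrix (Modes D m) (Modes D m) ℂ) ∈ unitaryGroup (Modes D m) ℂ := by
  rw [mem_unitaryGroup_iff]
  ext x z
  have : modePartner l x = modePartner l z ↔ x = z :=
    (Function.Involutive.injective (modePartner_modePartner l)).eq_iff
  by_cases h : x = z
  · subst h; simp [mul_apply, swapMatrix, apply_ite]
  · have h' : ¬ modePartner l z = modePartner l x := fun h' => h (this.1 h'.symm)
    simp [mul_apply, swapMatrix, one_apply, apply_ite, h, h']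

theorem weight_swapMatrix_mulVec (l : Fin D × Bool) (f : Modes D m → ℝ) (v : Modes D m → ℂ) :
    weight f (swapMatrix l *ᵥ v) = weight (fun x => f (modePartner l x)) v := by
  simp only [weight, swapMatrix_mulVec]
  rw [← sum_comp_modePartner l]
  simp only [modePartner_modePartner]

theorem weight_add_weight_modePartner (l : Fin D × Bool) (f : Modes D m → ℝ)
    (v : Modes D m → ℂ) :
    weight f v + weight (fun x => f (modePartner l x)) v = 2 * weight (modeAvg l f) v := by
  simp only [weight, Finset.mul_sum, ← Finset.sum_add_distrib, modeAvg]
  exact Finset.sum_congr rfl fun x _ => by ring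

theorem continuous_weight (f : Modes D m → ℝ) (ps : List (Fin d × (Fin D × Bool)))
    (v : Modes D m → ℂ) : Continuous fun u : Gates D m d => weight f (layerProd u ps *ᵥ v) := by
  refine continuous_finsetSum _ fun x _ => continuous_const.mul (Continuous.pow ?_ 2)
  exact continuous_norm.comp ((continuous_apply x).comp
    ((continuous_layerProd ps).matrix_mulVec continuous_const))

theorem integrable_of_continuous {E : Type*} [NormedAddCommGroup E] (μ : Measure (Gates D m d))
    [IsProbabilityMeasure μ] {F : Gates D m d → E} (hF : Continuous F) : Integrable F μ :=
  hF.integrable_of_hasCompactSupport (HasCompactSupport.of_compactSpace F)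

/-- Swapping the modes of each block preserves `μ` and does not affect `g`, so `f` may be replaced
by its block average. Both functions are then constant on blocks and the layer drops out; no
fourth-order Haar moments of a gate are needed. -/
theorem integral_weight_mul_weight_cons_of_const_right (μ : Measure (Gates D m d)) [IsProbabilityMeasure μ]
    [μ.IsMulLeftInvariant] {p : Fin d × (Fin D × Bool)} {ps : List (Fin d × (Fin D × Bool))}
    (hp : p ∉ ps) (f : Modes D m → ℝ) {g : Modes D m → ℝ} (hg : ∀ x, g (modePartner p.2 x) = g x)
    (v : Modes D m → ℂ) :
    ∫ u, weight f (layerProd u (p :: ps) *ᵥ v) * weight g (layerProd u (p :: ps) *ᵥ v) ∂μ =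
      ∫ u, weight (modeAvg p.2 f) (layerProd u ps *ᵥ v) * weight g (layerProd u ps *ᵥ v) ∂μ := by
  obtain ⟨h, hh⟩ := exists_gates_mul (d := d) p (swapMatrix_mem_unitaryGroup (m := m) p.2)
    (fun x y hxy => by
      rw [swapMatrix, if_neg]
      rintro rfl
      exact hxy (blockLabel_modePartner _ _))
  have e1 : ∫ u, weight f (layerProd u (p :: ps) *ᵥ v) * weight g (layerProd u (p :: ps) *ᵥ v) ∂μ =
      ∫ u, weight (fun x => f (modePartner p.2 x)) (layerProd u (p :: ps) *ᵥ v) *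
        weight g (layerProd u (p :: ps) *ᵥ v) ∂μ := by
    rw [← integral_mul_left_eq_self _ h]
    refine integral_congr_ae (Filter.Eventually.of_forall fun u => ?_)
    have e : layerProd (h * u) (p :: ps) = swapMatrix p.2 * layerProd u (p :: ps) := by
      rw [layerProd_cons, layerProd_cons, (hh u).1.1, Matrix.mul_assoc,
        layerProd_congr fun q hq => (hh u).1.2 q (by rintro rfl; exact hp hq)]
    simp only [e, ← mulVec_mulVec, weight_swapMatrix_mulVec, hg]
  have e2 := integral_add
    (integrable_of_continuous μ ((continuous_weight f (p :: ps) v).mul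
      (continuous_weight g (p :: ps) v)))
    (integrable_of_continuous μ ((continuous_weight (fun x => f (modePartner p.2 x)) (p :: ps) v).mul
      (continuous_weight g (p :: ps) v)))
  simp only [Pi.mul_apply] at e2
  rw [← e1, ← two_mul] at e2
  simp only [← add_mul, weight_add_weight_modePartner, mul_assoc] at e2
  rw [integral_const_mul] at e2
  rw [← mul_left_cancel₀ two_ne_zero e2]
  refine integral_congr_ae (Filter.Eventually.of_forall fun u => ?_)
  simp only [layerProd_cons, ← mulVec_mulVec]
  rw [layerAt, weight_layer_mulVec _ (modeAvg_modePartner _ _), weight_layer_mulVec _ hg]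

theorem integral_weight_mul_weight_cons (μ : Measure (Gates D m d)) [IsProbabilityMeasure μ]
    [μ.IsMulLeftInvariant] {p : Fin d × (Fin D × Bool)} {ps : List (Fin d × (Fin D × Bool))}
    (hp : p ∉ ps) {f g : Modes D m → ℝ}
    (hfg : (∀ x, f (modePartner p.2 x) = f x) ∨ ∀ x, g (modePartner p.2 x) = g x)
    (v : Modes D m → ℂ) :
    ∫ u, weight f (layerProd u (p :: ps) *ᵥ v) * weight g (layerProd u (p :: ps) *ᵥ v) ∂μ =
      ∫ u, weight (modeAvg p.2 f) (layerProd u ps *ᵥ v) *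
        weight (modeAvg p.2 g) (layerProd u ps *ᵥ v) ∂μ := by
  rcases hfg with hf | hg
  · rw [modeAvg_eq_self hf]
    simp only [mul_comm (weight f _)]
    exact integral_weight_mul_weight_cons_of_const_right μ hp g hf v
  · rw [modeAvg_eq_self hg]
    exact integral_weight_mul_weight_cons_of_const_right μ hp f hg v

/-- The averages over the blocks of a sequence of layers, the head of the list being used
first. -/
noncomputable def iterModeAvg :
    List (Fin d × (Fin D × Bool)) → (Modes D m → ℝ) → Modes D m → ℝ
  | [], f => f
  | p :: ps, f => iterModeAvg ps (modeAvg p.2 f)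

/-- The function does not depend on the coordinate `j`. -/
def IndepOf (j : Fin D) (f : Modes D m → ℝ) : Prop := ∀ x a, f (Function.update x j a) = f x

theorem IndepOf.modeAvg {j : Fin D} {f : Modes D m → ℝ} (hf : IndepOf j f) (l : Fin D × Bool) :
    IndepOf j (modeAvg l f) := by
  intro x a
  rw [BosonicBrickwork.modeAvg, BosonicBrickwork.modeAvg, hf]
  congr 2
  by_cases h : l.1 = j
  · rw [modePartner, modePartner, h, hf, hf, hf]
  · have : modePartner l (Function.update x j a) = Function.update (modePartner l x) j a := by
      rw [modePartner, modePartner, Function.update_of_ne h, Function.update_comm h]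
    rw [this, hf]

/-- Each layer moves only one of the two particles if their positions are tested in
complementary sets of directions. -/
theorem integral_weight_mul_weight (μ : Measure (Gates D m d)) [IsProbabilityMeasure μ]
    [μ.IsMulLeftInvariant] {ps : List (Fin d × (Fin D × Bool))} (hps : ps.Nodup)
    {f g : Modes D m → ℝ} (hfg : ∀ j, IndepOf j f ∨ IndepOf j g) (v : Modes D m → ℂ) :
    ∫ u, weight f (layerProd u ps *ᵥ v) * weight g (layerProd u ps *ᵥ v) ∂μ =
      weight (iterModeAvg ps f) v * weight (iterModeAvg ps g) v := by
  induction ps generalizing f g with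
  | nil => simp [layerProd, iterModeAvg]
  | cons p ps ih =>
    rw [List.nodup_cons] at hps
    rw [integral_weight_mul_weight_cons μ hps.1
      ((hfg p.2.1).imp (fun h x => h x _) (fun h x => h x _)), iterModeAvg, iterModeAvg]
    exact ih hps.2 fun j => (hfg j).imp (fun h => h.modeAvg _) (fun h => h.modeAvg _)

/-- The last position in the list is the layer applied first. Multiplying its column `z` by i
preserves the measure and multiplies the integrand by i² = -1. -/
theorem integral_cross_eq_zero (μ : Measure (Gates D m d)) [μ.IsMulRightInvariant]
    {qs : List (Fin d × (Fin D × Bool))} {p : Fin d × (Fin D × Bool)} (hp : p ∉ qs)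
    (x y : Modes D m) {z z' : Modes D m} (hz : z ≠ z') :
    ∫ u, layerProd u (qs ++ [p]) x z * layerProd u (qs ++ [p]) y z *
      star (layerProd u (qs ++ [p]) x z' * layerProd u (qs ++ [p]) y z') ∂μ = 0 := by
  set V : Matrix (Modes D m) (Modes D m) ℂ :=
    diagonal fun w => if w = z then Complex.I else 1 with hV
  have hVu : V ∈ unitaryGroup (Modes D m) ℂ := by
    rw [mem_unitaryGroup_iff, hV, star_eq_conjTranspose, diagonal_conjTranspose,
      diagonal_mul_diagonal, ← diagonal_one]
    congr 1
    funext w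
    by_cases h : w = z <;> simp [h]
  obtain ⟨g, hg⟩ := exists_gates_mul (d := d) p hVu
    (fun x y hxy => diagonal_apply_ne _ fun h => hxy (by rw [h]))
  have e : ∀ u, layerProd (u * g) (qs ++ [p]) = layerProd u (qs ++ [p]) * V := by
    intro u
    have h1 := layerProd_congr (u := u * g) (u' := u) (ps := qs)
      fun q hq => (hg u).2.2 q (by rintro rfl; exact hp hq)
    simp only [layerProd, List.map_append, List.prod_append, List.map_cons, List.map_nil,
      List.prod_singleton, (hg u).2.1] at h1 ⊢
    rw [h1, Matrix.mul_assoc]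
  have h := integral_mul_right_eq_self (μ := μ) (fun u => layerProd u (qs ++ [p]) x z *
    layerProd u (qs ++ [p]) y z * star (layerProd u (qs ++ [p]) x z' *
      layerProd u (qs ++ [p]) y z')) g
  simp only [e, hV, mul_diagonal, if_true, hz.symm, if_false, mul_one] at h
  have h2 : ∀ a b c : ℂ, a * Complex.I * (b * Complex.I) * c = -(a * b * c) := by
    intro a b c
    linear_combination (a * b * c) * Complex.I_mul_I
  simp only [h2, integral_neg] at h
  linear_combination (-1 / 2 : ℂ) * h

theorem integral_norm_sq_mul_transpose (μ : Measure (Gates D m d)) [IsProbabilityMeasure μ]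
    [μ.IsMulRightInvariant] {qs : List (Fin d × (Fin D × Bool))} {p : Fin d × (Fin D × Bool)}
    (hp : p ∉ qs) (x y : Modes D m) :
    ∫ u, ‖(layerProd u (qs ++ [p]) * (layerProd u (qs ++ [p]))ᵀ) x y‖ ^ 2 ∂μ =
      ∑ z, ∫ u, ‖layerProd u (qs ++ [p]) x z‖ ^ 2 * ‖layerProd u (qs ++ [p]) y z‖ ^ 2 ∂μ := by
  have hc : ∀ a b : Modes D m, Continuous fun u : Gates D m d => layerProd u (qs ++ [p]) a b :=
    fun a b => (continuous_layerProd _).matrix_elem a b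
  have e : ∀ u : Gates D m d,
      ((‖(layerProd u (qs ++ [p]) * (layerProd u (qs ++ [p]))ᵀ) x y‖ ^ 2 : ℝ) : ℂ) =
      ∑ z, ∑ z', layerProd u (qs ++ [p]) x z * layerProd u (qs ++ [p]) y z *
        star (layerProd u (qs ++ [p]) x z' * layerProd u (qs ++ [p]) y z') := by
    intro u
    rw [← Finset.sum_mul_sum, ← star_sum]
    simp only [mul_apply, transpose_apply]
    push_cast
    rw [← Complex.mul_conj']
    rfl
  have hc2 : ∀ z z', Continuous fun u : Gates D m d =>
      layerProd u (qs ++ [p]) x z * layerProd u (qs ++ [p]) y z *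
        star (layerProd u (qs ++ [p]) x z' * layerProd u (qs ++ [p]) y z') :=
    fun z z' => ((hc _ _).mul (hc _ _)).mul ((hc _ _).mul (hc _ _)).star
  rw [← Complex.ofReal_inj, ← integral_complex_ofReal]
  simp only [e]
  rw [integral_finsetSum _ fun z _ => integrable_of_continuous μ <|
    continuous_finsetSum _ fun z' _ => hc2 z z']
  push_cast
  refine Finset.sum_congr rfl fun z _ => ?_
  rw [integral_finsetSum _ fun z' _ => integrable_of_continuous μ (hc2 z z'),
    Finset.sum_eq_single z]
  · rw [← integral_complex_ofReal]
    refine integral_congr_ae (Filter.Eventually.of_forall fun u => ?_)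
    simp only
    push_cast
    rw [Complex.star_def, Complex.mul_conj', norm_mul]
    push_cast
    ring
  · intro z' _ hz'
    exact integral_cross_eq_zero μ hp x y hz'.symm
  · simp

/-- Two-particle picture: both particles start at `z` and evolve by the same circuit, one being
found in Γ and the other outside. -/
theorem integral_sum_norm_sq (μ : Measure (Gates D m d)) [IsProbabilityMeasure μ]
    [μ.IsMulRightInvariant] {qs : List (Fin d × (Fin D × Bool))} {p : Fin d × (Fin D × Bool)}
    (hp : p ∉ qs) (Γ : Finset (Modes D m)) :
    ∫ u, ∑ x ∈ Γ, ∑ y ∈ Γᶜ,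
        ‖(layerProd u (qs ++ [p]) * (layerProd u (qs ++ [p]))ᵀ) x y‖ ^ 2 ∂μ =
      ∑ z, ∫ u, weight (fun x => if x ∈ Γ then 1 else 0)
          (layerProd u (qs ++ [p]) *ᵥ Pi.single z 1) *
        weight (fun x => if x ∈ Γ then 0 else 1)
          (layerProd u (qs ++ [p]) *ᵥ Pi.single z 1) ∂μ := by
  have hc : ∀ a b : Modes D m,
      Continuous fun u : Gates D m d => ‖layerProd u (qs ++ [p]) a b‖ ^ 2 :=
    fun a b => ((continuous_layerProd _).matrix_elem a b).norm.pow 2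
  have hc' : ∀ a b : Modes D m, Continuous fun u : Gates D m d =>
      ‖(layerProd u (qs ++ [p]) * (layerProd u (qs ++ [p]))ᵀ) a b‖ ^ 2 := fun a b =>
    (((continuous_layerProd _).matrix_mul (continuous_layerProd _).matrix_transpose).matrix_elem
      a b).norm.pow 2
  have hc2 : ∀ x y z : Modes D m, Continuous fun u : Gates D m d =>
      ‖layerProd u (qs ++ [p]) x z‖ ^ 2 * ‖layerProd u (qs ++ [p]) y z‖ ^ 2 :=
    fun x y z => (hc x z).mul (hc y z)
  have e : ∀ (u : Gates D m d) (z : Modes D m),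
      weight (fun x => if x ∈ Γ then 1 else 0) (layerProd u (qs ++ [p]) *ᵥ Pi.single z 1) *
        weight (fun x => if x ∈ Γ then 0 else 1) (layerProd u (qs ++ [p]) *ᵥ Pi.single z 1) =
      ∑ x ∈ Γ, ∑ y ∈ Γᶜ,
        ‖layerProd u (qs ++ [p]) x z‖ ^ 2 * ‖layerProd u (qs ++ [p]) y z‖ ^ 2 := by
    intro u z
    rw [← Finset.sum_mul_sum, weight, weight, mulVec_single_one]
    congr 1
    · rw [← Finset.sum_subset (Finset.subset_univ Γ)]
      · exact Finset.sum_congr rfl fun x hx => by simp [hx]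
      · intro x _ hx; simp [hx]
    · rw [← Finset.sum_subset (Finset.subset_univ Γᶜ)]
      · exact Finset.sum_congr rfl fun x hx => by simp [Finset.mem_compl.1 hx]
      · intro x _ hx; rw [Finset.mem_compl, not_not] at hx; simp [hx]
  simp only [e]
  rw [integral_finsetSum _ fun x _ => integrable_of_continuous μ <|
    continuous_finsetSum _ fun y _ => hc' x y]
  have e1 : ∀ x ∈ Γ, ∫ u, ∑ y ∈ Γᶜ,
      ‖(layerProd u (qs ++ [p]) * (layerProd u (qs ++ [p]))ᵀ) x y‖ ^ 2 ∂μ =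
      ∑ z, ∑ y ∈ Γᶜ, ∫ u,
        ‖layerProd u (qs ++ [p]) x z‖ ^ 2 * ‖layerProd u (qs ++ [p]) y z‖ ^ 2 ∂μ := by
    intro x _
    rw [integral_finsetSum _ fun y _ => integrable_of_continuous μ (hc' x y), Finset.sum_comm]
    exact Finset.sum_congr rfl fun y _ => integral_norm_sq_mul_transpose μ hp x y
  rw [Finset.sum_congr rfl e1, Finset.sum_comm]
  refine Finset.sum_congr rfl fun z _ => ?_
  rw [integral_finsetSum _ fun x _ => integrable_of_continuous μ <|
    continuous_finsetSum _ fun y _ => hc2 x y z]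
  refine Finset.sum_congr rfl fun x _ => ?_
  rw [integral_finsetSum _ fun y _ => integrable_of_continuous μ (hc2 x y z)]

/-! ### The average-case bound -/

/-- The product of functions of the coordinates. -/
noncomputable def prodFun (F : Fin D → Fin m → ℝ) (x : Modes D m) : ℝ := ∏ i, F i (x i)

/-- The sides of the layers in direction `j`. -/
def sides (ps : List (Fin d × (Fin D × Bool))) (j : Fin D) : List Bool :=
  (ps.filter fun p => p.2.1 = j).map fun p => p.2.2

theorem modeAvg_prodFun (l : Fin D × Bool) (F : Fin D → Fin m → ℝ) :
    modeAvg l (prodFun F) = prodFun (Function.update F l.1 (blockAvg l.2 (F l.1))) := by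
  funext x
  have h1 : ∀ G : Fin D → Fin m → ℝ, ∀ y : Modes D m,
      prodFun G y = G l.1 (y l.1) * ∏ i ∈ Finset.univ.erase l.1, G i (y i) := fun G y =>
    (Finset.mul_prod_erase _ (fun i => G i (y i)) (Finset.mem_univ l.1)).symm
  have h2 : ∏ i ∈ Finset.univ.erase l.1, F i (modePartner l x i) =
      ∏ i ∈ Finset.univ.erase l.1, F i (x i) :=
    Finset.prod_congr rfl fun i hi => by
      rw [modePartner, Function.update_of_ne (Finset.ne_of_mem_erase hi)]
  have h3 : ∏ i ∈ Finset.univ.erase l.1, Function.update F l.1 (blockAvg l.2 (F l.1)) i (x i) =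
      ∏ i ∈ Finset.univ.erase l.1, F i (x i) :=
    Finset.prod_congr rfl fun i hi => by
      rw [Function.update_of_ne (Finset.ne_of_mem_erase hi)]
  rw [modeAvg, h1, h1 F, h1 _ x, h2, h3, Function.update_self, blockAvg, modePartner,
    Function.update_self]
  ring

theorem iterModeAvg_prodFun (ps : List (Fin d × (Fin D × Bool))) (F : Fin D → Fin m → ℝ) :
    iterModeAvg ps (prodFun F) = prodFun fun i => iterAvg (sides ps i) (F i) := by
  induction ps generalizing F with
  | nil => rfl
  | cons p ps ih =>
    rw [iterModeAvg, modeAvg_prodFun, ih]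
    congr 1
    funext i
    by_cases h : p.2.1 = i
    · subst h
      rw [Function.update_self, sides, sides, List.filter_cons_of_pos (by simp), List.map_cons,
        iterAvg]
    · rw [Function.update_of_ne (fun h' => h h'.symm), sides, sides,
        List.filter_cons_of_neg (by simpa using h)]

theorem iterAvg_one (l : List Bool) :
    iterAvg l (fun _ : Fin m => (1 : ℝ)) = fun _ => 1 := by
  induction l with
  | nil => rfl
  | cons b l ih =>
    have : blockAvg b (fun _ : Fin m => (1 : ℝ)) = fun _ => 1 := by
      funext a; simp [blockAvg]
    rw [iterAvg, this, ih]

theorem length_sides_le {ps : List (Fin d × (Fin D × Bool))} (hps : ps.Nodup) (j : Fin D) :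
    (sides ps j).length ≤ 2 * d := by
  rw [sides, List.length_map, ← List.toFinset_card_of_nodup (hps.filter _)]
  calc _ ≤ (Finset.univ.image fun q : Fin d × Bool => ((q.1, (j, q.2)) :
        Fin d × (Fin D × Bool))).card := by
        refine Finset.card_le_card fun p hp => ?_
        simp only [List.mem_toFinset, List.mem_filter, decide_eq_true_eq] at hp
        rw [Finset.mem_image]
        exact ⟨(p.1, p.2.2), Finset.mem_univ _, by rw [← hp.2]⟩
    _ ≤ (Finset.univ : Finset (Fin d × Bool)).card := Finset.card_image_le
    _ = 2 * d := by simp [mul_comm]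

theorem indepOf_prodFun {j : Fin D} {F : Fin D → Fin m → ℝ} (h : F j = fun _ => 1) :
    IndepOf j (prodFun F) := by
  intro x a
  refine Finset.prod_congr rfl fun i _ => ?_
  by_cases hi : i = j
  · subst hi; rw [h]
  · rw [Function.update_of_ne hi]

/-- The indicator function of `{0, …, k - 1}`. -/
noncomputable def ltInd (m k : ℕ) (a : Fin m) : ℝ := if (a : ℕ) < k then 1 else 0

theorem ltInd_nonneg (m k : ℕ) (a : Fin m) : 0 ≤ ltInd m k a := by
  unfold ltInd; split_ifs <;> norm_num

theorem ltInd_le_one (m k : ℕ) (a : Fin m) : ltInd m k a ≤ 1 := by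
  unfold ltInd; split_ifs <;> norm_num

theorem box_indicator (k : Fin D → ℕ) (x : Modes D m) :
    (if x ∈ box m k then (1 : ℝ) else 0) = prodFun (fun i => ltInd m (k i)) x := by
  simp only [box, Finset.mem_filter, Finset.mem_univ, true_and, prodFun, ltInd]
  rw [Finset.prod_ite_zero]
  simp

/-- Union bound over the violated constraint. Directions with `k j = m` cannot be violated, which
produces the indicator in the boundary area. -/
theorem compl_box_indicator_le (k : Fin D → ℕ) (x : Modes D m) :
    (if x ∈ box m k then (0 : ℝ) else 1) ≤
      ∑ j, (if k j < m then 1 else 0) * (1 - ltInd m (k j) (x j)) := by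
  have h0 : ∀ j ∈ Finset.univ,
      0 ≤ (if k j < m then (1 : ℝ) else 0) * (1 - ltInd m (k j) (x j)) := fun j _ =>
    mul_nonneg (by split_ifs <;> norm_num) (by linarith [ltInd_le_one m (k j) (x j)])
  split_ifs with h
  · exact Finset.sum_nonneg h0
  · simp only [box, Finset.mem_filter, Finset.mem_univ, true_and] at h
    push Not at h
    obtain ⟨j, hj⟩ := h
    refine le_trans ?_ (Finset.single_le_sum h0 (Finset.mem_univ j))
    have := (x j).2
    rw [if_pos (by omega), ltInd, if_neg (by omega)]
    norm_num

theorem sum_ltInd_le (m k : ℕ) : ∑ a, ltInd m k a ≤ k := by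
  simp only [ltInd]
  rw [Finset.sum_boole]
  exact_mod_cast card_lt_le m k

theorem prodFun_nonneg {F : Fin D → Fin m → ℝ} (h : ∀ i a, 0 ≤ F i a) (x : Modes D m) :
    0 ≤ prodFun F x :=
  Finset.prod_nonneg fun i _ => h i _

theorem sum_prodFun (F : Fin D → Fin m → ℝ) : ∑ x, prodFun F x = ∏ i, ∑ a, F i a := by
  rw [Finset.prod_univ_sum, Fintype.piFinset_univ]
  rfl

theorem prodFun_eq_update_mul (F : Fin D → Fin m → ℝ) (j : Fin D) (x : Modes D m) :
    prodFun F x = prodFun (Function.update F j fun _ => 1) x * F j (x j) := by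
  rw [prodFun, prodFun, ← Finset.mul_prod_erase _ _ (Finset.mem_univ j),
    ← Finset.mul_prod_erase _ (fun i => Function.update F j (fun _ => 1) i (x i))
      (Finset.mem_univ j), Function.update_self, one_mul, mul_comm]
  congr 1
  exact Finset.prod_congr rfl fun i hi => by
    rw [Function.update_of_ne (Finset.ne_of_mem_erase hi)]

theorem prodFun_update_one (j : Fin D) (f : Fin m → ℝ) (x : Modes D m) :
    prodFun (Function.update (fun _ _ => 1) j f) x = f (x j) := by
  rw [prodFun, Finset.prod_eq_single j]
  · simp
  · intro i _ hi; simp [hi]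
  · simp

/-- Both events constrain coordinate `j`, which blocks the exact factorization. Only the constraint
describing a move across the cut from `z` is kept, so the remaining factor is the deficit or the
leaked mass at `z j`. -/
theorem integral_crossing_le (μ : Measure (Gates D m d)) [IsProbabilityMeasure μ]
    [μ.IsMulLeftInvariant] {ps : List (Fin d × (Fin D × Bool))} (hps : ps.Nodup)
    (k : Fin D → ℕ) (j : Fin D) (z : Modes D m) :
    ∫ u, weight (prodFun fun i => ltInd m (k i)) (layerProd u ps *ᵥ Pi.single z 1) *
        weight (fun x => 1 - ltInd m (k j) (x j)) (layerProd u ps *ᵥ Pi.single z 1) ∂μ ≤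
      prodFun (Function.update (fun i => iterAvg (sides ps i) (ltInd m (k i))) j
        fun a => if (a : ℕ) < k j then 1 - iterAvg (sides ps j) (ltInd m (k j)) a
          else iterAvg (sides ps j) (ltInd m (k j)) a) z := by
  have hF0 : ∀ x : Modes D m, 0 ≤ prodFun (fun i => ltInd m (k i)) x :=
    prodFun_nonneg fun i a => ltInd_nonneg _ _ _
  have hg0 : ∀ x : Modes D m, 0 ≤ 1 - ltInd m (k j) (x j) :=
    fun x => by linarith [ltInd_le_one m (k j) (x j)]
  have hg : (fun x : Modes D m => 1 - ltInd m (k j) (x j)) =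
      prodFun (Function.update (fun _ _ => 1) j fun a => 1 - ltInd m (k j) a) := by
    funext x; rw [prodFun_update_one]
  have hint : ∀ f g : Modes D m → ℝ, Integrable (fun u : Gates D m d =>
      weight f (layerProd u ps *ᵥ Pi.single z 1) * weight g (layerProd u ps *ᵥ Pi.single z 1)) μ :=
    fun f g => integrable_of_continuous μ ((continuous_weight f ps _).mul (continuous_weight g ps _))
  rw [prodFun_eq_update_mul _ j]
  simp only [Function.update_idem, Function.update_self]
  split_ifs with hz
  · have e := integral_weight_mul_weight μ hps
      (f := prodFun (Function.update (fun i => ltInd m (k i)) j fun _ => 1))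
      (g := fun x => 1 - ltInd m (k j) (x j)) (fun i => by
        by_cases hi : i = j
        · left
          subst hi
          exact indepOf_prodFun (by simp)
        · right
          rw [hg]
          exact indepOf_prodFun (by simp [hi])) (Pi.single z 1)
    rw [weight_single, weight_single, iterModeAvg_prodFun] at e
    have e1 : (fun i => iterAvg (sides ps i)
        (Function.update (fun i => ltInd m (k i)) j (fun _ => 1) i)) =
        Function.update (fun i => iterAvg (sides ps i) (ltInd m (k i))) j fun _ => 1 := by
      funext i
      by_cases hi : i = j
      · subst hi; simp [iterAvg_one]
      · simp [hi]
    have e2 : iterModeAvg ps (fun x : Modes D m => 1 - ltInd m (k j) (x j)) z =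
        1 - iterAvg (sides ps j) (ltInd m (k j)) (z j) := by
      rw [hg, iterModeAvg_prodFun, prodFun, Finset.prod_eq_single j]
      · rw [Function.update_self, iterAvg_one_sub]
      · intro i _ hi; rw [Function.update_of_ne hi, iterAvg_one]
      · simp
    rw [e1, e2] at e
    rw [← e]
    refine integral_mono (hint _ _) (hint _ _) fun u => ?_
    refine mul_le_mul_of_nonneg_right (weight_mono (fun x => ?_) _) (weight_nonneg hg0 _)
    rw [prodFun_eq_update_mul _ j]
    exact mul_le_of_le_one_right (prodFun_nonneg (fun i a => by
      by_cases hi : i = j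
      · subst hi; simp
      · simp [hi, ltInd_nonneg]) _) (ltInd_le_one _ _ _)
  · have e := integral_weight_mul_weight μ hps (f := prodFun fun i => ltInd m (k i))
      (g := prodFun fun _ _ => 1) (fun i => Or.inr (indepOf_prodFun rfl)) (Pi.single z 1)
    rw [weight_single, weight_single, iterModeAvg_prodFun, iterModeAvg_prodFun] at e
    have e1 : prodFun (fun i => iterAvg (sides ps i) fun _ : Fin m => (1 : ℝ)) z = 1 := by
      simp [iterAvg_one, prodFun]
    rw [e1, mul_one, prodFun_eq_update_mul _ j] at e
    rw [← e]
    refine integral_mono (hint _ _) (hint _ _) fun u => ?_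
    refine mul_le_mul_of_nonneg_left (weight_mono (fun x => ?_) _) (weight_nonneg hF0 _)
    simp [prodFun, ltInd_nonneg]

/-- The sum factorizes over coordinates. Averages preserve mass, at most `k l` for l ≠ j, and
direction `j` contributes the leak after at most 2d averages. -/
theorem sum_crossing_le {ps : List (Fin d × (Fin D × Bool))} (hps : ps.Nodup) {k : Fin D → ℕ}
    (hk : ∀ j, k j ≤ m) (j : Fin D) :
    ∑ z, prodFun (Function.update (fun i => iterAvg (sides ps i) (ltInd m (k i))) j
        fun a => if (a : ℕ) < k j then 1 - iterAvg (sides ps j) (ltInd m (k j)) a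
          else iterAvg (sides ps j) (ltInd m (k j)) a) z ≤
      (∏ l ∈ Finset.univ.erase j, (k l : ℝ)) * (2 * Real.sqrt d) := by
  rw [sum_prodFun, ← Finset.mul_prod_erase _ _ (Finset.mem_univ j), mul_comm]
  refine mul_le_mul ?_ ?_ ?_ (Finset.prod_nonneg fun l _ => Nat.cast_nonneg _)
  · refine Finset.prod_le_prod (fun i hi => Finset.sum_nonneg fun a _ => ?_) fun i hi => ?_
    · rw [Function.update_of_ne (Finset.ne_of_mem_erase hi)]
      exact iterAvg_nonneg _ (ltInd_nonneg _ _) _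
    · rw [Function.update_of_ne (Finset.ne_of_mem_erase hi), sum_iterAvg]
      exact sum_ltInd_le m (k i)
  · rw [Function.update_self]
    refine (leak_bounds (hk j) (sides ps j)).trans ?_
    have : ((sides ps j).length : ℝ) ≤ 2 * d := by exact_mod_cast length_sides_le hps j
    gcongr
    linarith
  · refine Finset.sum_nonneg fun a _ => ?_
    rw [Function.update_self]
    split_ifs
    · linarith [iterAvg_le_one (sides ps j) (ltInd_le_one m (k j)) a]
    · exact iterAvg_nonneg _ (ltInd_nonneg _ _) _

theorem integral_sum_norm_sq_le (μ : Measure (Gates D m d)) [IsProbabilityMeasure μ]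
    [μ.IsMulLeftInvariant] [μ.IsMulRightInvariant] {ps : List (Fin d × (Fin D × Bool))}
    (hps : ps.Nodup) (hne : ps ≠ []) {k : Fin D → ℕ} (hk : ∀ j, k j ≤ m) :
    ∫ u, ∑ x ∈ box m k, ∑ y ∈ (box m k)ᶜ, ‖(layerProd u ps * (layerProd u ps)ᵀ) x y‖ ^ 2 ∂μ ≤
      2 * Real.sqrt d * boundaryArea m k := by
  have hint : ∀ (f g : Modes D m → ℝ) (z : Modes D m), Integrable (fun u : Gates D m d =>
      weight f (layerProd u ps *ᵥ Pi.single z 1) * weight g (layerProd u ps *ᵥ Pi.single z 1)) μ :=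
    fun f g z =>
      integrable_of_continuous μ ((continuous_weight f ps _).mul (continuous_weight g ps _))
  have hF0 : ∀ x : Modes D m, 0 ≤ prodFun (fun i => ltInd m (k i)) x :=
    prodFun_nonneg fun i a => ltInd_nonneg _ _ _
  have key : ∀ z : Modes D m,
      ∫ u, weight (fun x => if x ∈ box m k then 1 else 0) (layerProd u ps *ᵥ Pi.single z 1) *
        weight (fun x => if x ∈ box m k then 0 else 1) (layerProd u ps *ᵥ Pi.single z 1) ∂μ ≤
      ∑ j, (if k j < m then 1 else 0) *
        prodFun (Function.update (fun i => iterAvg (sides ps i) (ltInd m (k i))) j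
        fun a => if (a : ℕ) < k j then 1 - iterAvg (sides ps j) (ltInd m (k j)) a
          else iterAvg (sides ps j) (ltInd m (k j)) a) z := by
    intro z
    simp only [box_indicator]
    calc _ ≤ ∫ u, ∑ j, (if k j < m then (1 : ℝ) else 0) *
          (weight (prodFun fun i => ltInd m (k i)) (layerProd u ps *ᵥ Pi.single z 1) *
          weight (fun x => 1 - ltInd m (k j) (x j)) (layerProd u ps *ᵥ Pi.single z 1)) ∂μ := by
          refine integral_mono (hint _ _ _)
            (integrable_finsetSum _ fun j _ => (hint _ _ z).const_mul _) fun u => ?_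
          have h := weight_mono (compl_box_indicator_le k) (layerProd u ps *ᵥ Pi.single z 1)
          have h' : weight (fun x : Modes D m =>
              ∑ j, (if k j < m then 1 else 0) * (1 - ltInd m (k j) (x j)))
                (layerProd u ps *ᵥ Pi.single z 1) =
              ∑ j, (if k j < m then 1 else 0) * weight (fun x => 1 - ltInd m (k j) (x j))
                (layerProd u ps *ᵥ Pi.single z 1) := by
            simp only [weight, Finset.sum_mul, Finset.mul_sum, mul_assoc]
            exact Finset.sum_comm
          rw [h'] at h
          refine (mul_le_mul_of_nonneg_left h (weight_nonneg hF0 _)).trans (le_of_eq ?_)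
          rw [Finset.mul_sum]
          exact Finset.sum_congr rfl fun j _ => by ring
      _ ≤ _ := by
          rw [integral_finsetSum _ fun j _ => (hint _ _ z).const_mul _]
          refine Finset.sum_le_sum fun j _ => ?_
          rw [integral_const_mul]
          exact mul_le_mul_of_nonneg_left (integral_crossing_le μ hps k j z)
            (by split_ifs <;> norm_num)
  -- Isolates the layer applied first, whose phases remove the interference terms.
  obtain ⟨qs, p, rfl⟩ := (List.eq_nil_or_concat' ps).resolve_left hne
  have hp : p ∉ qs := by
    intro h
    rw [List.nodup_append] at hps
    exact hps.2.2 p h p (by simp) rfl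
  rw [integral_sum_norm_sq μ hp]
  refine (Finset.sum_le_sum fun z _ => key z).trans ?_
  rw [Finset.sum_comm, boundaryArea]
  push_cast
  rw [Finset.mul_sum]
  refine Finset.sum_le_sum fun j _ => ?_
  rw [← Finset.mul_sum]
  refine (mul_le_mul_of_nonneg_left (sum_crossing_le hps hk j)
    (by split_ifs <;> norm_num)).trans (le_of_eq ?_)
  ring

theorem continuous_quadratureMatrix {ι : Type*} :
    Continuous fun U : Matrix ι ι ℂ => quadratureMatrix U :=
  have hr : Continuous fun U : Matrix ι ι ℂ => U.map Complex.re :=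
    continuous_id.matrix_map Complex.continuous_re
  have hi : Continuous fun U : Matrix ι ι ℂ => U.map Complex.im :=
    continuous_id.matrix_map Complex.continuous_im
  hr.matrix_fromBlocks hi hi.neg hr

theorem continuous_renyi2_layerProd (s : ℝ) (Γ : Finset (Modes D m))
    (ps : List (Fin d × (Fin D × Bool))) :
    Continuous fun u : Gates D m d => renyi2 s Γ (layerProd u ps) := by
  have hq := continuous_quadratureMatrix.comp (continuous_layerProd (D := D) (m := m) ps)
  have hc : Continuous fun u : Gates D m d => reducedCov s Γ (layerProd u ps) :=
    ((hq.matrix_mul continuous_const).matrix_mul hq.matrix_transpose).matrix_submatrix _ _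
  exact continuous_const.mul (hc.matrix_det.log fun u =>
    det_reducedCov_ne_zero s Γ ⟨_, layerProd_mem_unitaryGroup u ps⟩)

theorem integral_renyi2_layerProd_le (μ : Measure (Gates D m d)) [IsProbabilityMeasure μ]
    [μ.IsMulLeftInvariant] [μ.IsMulRightInvariant] {ps : List (Fin d × (Fin D × Bool))}
    (hps : ps.Nodup) (hne : ps ≠ []) {k : Fin D → ℕ} (hk : ∀ j, k j ≤ m) (s : ℝ) :
    ∫ u, renyi2 s (box m k) (layerProd u ps) ∂μ ≤
      Real.sqrt d * boundaryArea m k * Real.sinh (2 * s) ^ 2 := by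
  have hcont : Continuous fun u : Gates D m d => ∑ x ∈ box m k, ∑ y ∈ (box m k)ᶜ,
      ‖(layerProd u ps * (layerProd u ps)ᵀ) x y‖ ^ 2 :=
    continuous_finsetSum _ fun x _ => continuous_finsetSum _ fun y _ =>
      (((continuous_layerProd _).matrix_mul (continuous_layerProd _).matrix_transpose).matrix_elem
        x y).norm.pow 2
  calc ∫ u, renyi2 s (box m k) (layerProd u ps) ∂μ
      ≤ ∫ u, 1 / 2 * Real.sinh (2 * s) ^ 2 * ∑ x ∈ box m k, ∑ y ∈ (box m k)ᶜ,
          ‖(layerProd u ps * (layerProd u ps)ᵀ) x y‖ ^ 2 ∂μ :=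
        integral_mono (integrable_of_continuous μ (continuous_renyi2_layerProd s _ ps))
          ((integrable_of_continuous μ hcont).const_mul _) fun u =>
            renyi2_le_sum s (box m k) ⟨_, layerProd_mem_unitaryGroup u ps⟩
    _ ≤ 1 / 2 * Real.sinh (2 * s) ^ 2 * (2 * Real.sqrt d * boundaryArea m k) := by
        rw [integral_const_mul]
        exact mul_le_mul_of_nonneg_left (integral_sum_norm_sq_le μ hps hne hk) (by positivity)
    _ = _ := by ring

theorem positions_ne_nil (hD : 1 ≤ D) (hd : 1 ≤ d)
    (ord : Fin d → (Fin (2 * D) ≃ Fin D × Bool)) : positions ord ≠ [] := by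
  have h : (⟨0, hd⟩, ord ⟨0, hd⟩ ⟨0, by omega⟩) ∈ positions ord := by
    rw [positions, List.mem_flatten]
    refine ⟨(List.ofFn fun t => ((⟨0, hd⟩ : Fin d), ord ⟨0, hd⟩ t)).reverse, ?_, ?_⟩
    · rw [List.mem_reverse, List.mem_ofFn]
      exact ⟨_, rfl⟩
    · rw [List.mem_reverse, List.mem_ofFn]
      exact ⟨_, rfl⟩
  exact List.ne_nil_of_mem h

end Circuit

end BosonicBrickwork

/-! ### Transfer from the Haar product measure to the given random gates -/

theorem corollary1 :
    -- worst-case bound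
    (∀ (D m d : ℕ), 1 ≤ D → Even m →
      ∀ (k : Fin D → ℕ), (∀ j, k j ≤ m) →
      ∀ (s : ℝ), 0 < s →
      ∀ (ord : Fin d → (Fin (2 * D) ≃ Fin D × Bool)) (u : Gates D m d),
        renyi2 s (box m k) (circuit ord u)
          ≤ 4 * d * boundaryArea m k * Real.log (Real.cosh (2 * s))) ∧
    -- average-case bound, with an absolute constant
    (∃ C : ℝ, 0 < C ∧
      ∀ (D m d : ℕ), 1 ≤ D → Even m → 2 ≤ d →
      ∀ (k : Fin D → ℕ), (∀ j, k j ≤ m) →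
      ∀ (s : ℝ), 0 < s →
      ∀ (ord : Fin d → (Fin (2 * D) ≃ Fin D × Bool))
        (Ω : Type*) [MeasurableSpace Ω] (P : Measure Ω) [IsProbabilityMeasure P]
        (G : ∀ a : GateIndex D m d, Ω → GateGroup a),
        (∀ a, Measurable (G a)) →
        (∀ a, (P.map (G a)).IsHaarMeasure) →
        iIndepFun G P →
        Integrable (fun ω => renyi2 s (box m k) (circuit ord fun a => G a ω)) P ∧
        ∫ ω, renyi2 s (box m k) (circuit ord fun a => G a ω) ∂P
          ≤ C * Real.sqrt (D * d * Real.log d) * boundaryArea m k * Real.sinh (2 * s) ^ 2) := by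
  refine ⟨fun D m d _ _ k _ s _ ord u => renyi2_circuit_le k s ord u, 2, two_pos, ?_⟩
  intro D m d hD _ hd k hk s _ ord Ω _ P _ G hG hHaar hind
  have hmeas : Measurable fun ω (a : GateIndex D m d) => G a ω := measurable_pi_lambda _ hG
  have hprob : ∀ a, IsProbabilityMeasure (P.map (G a)) := fun a =>
    Measure.isProbabilityMeasure_map (hG a).aemeasurable
  have hlaw := (iIndepFun_iff_map_fun_eq_pi_map fun a => (hG a).aemeasurable).1 hind
  set μ : Measure (Gates D m d) := P.map fun ω a => G a ω with hμ
  have hμprob : IsProbabilityMeasure μ := Measure.isProbabilityMeasure_map hmeas.aemeasurable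
  -- By independence the joint law is the product of the Haar laws, itself a Haar measure on the
  -- product group.
  have hμhaar : μ.IsHaarMeasure := by
    rw [hlaw]
    exact Measure.pi.isHaarMeasure _
  have hμright : μ.IsMulRightInvariant := isMulRightInvariant_of_compactSpace μ
  have hcont := continuous_renyi2_layerProd (d := d) s (box m k) (positions ord)
  simp only [circuit_eq_layerProd]
  constructor
  · exact (integrable_of_continuous μ hcont).comp_measurable hmeas
  · have e : ∫ ω, renyi2 s (box m k) (layerProd (fun a => G a ω) (positions ord)) ∂P =
        ∫ u, renyi2 s (box m k) (layerProd u (positions ord)) ∂μ :=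
      (integral_map hmeas.aemeasurable hcont.aestronglyMeasurable).symm
    rw [e]
    refine (integral_renyi2_layerProd_le μ (nodup_positions ord)
      (positions_ne_nil hD (by omega) ord) hk s).trans ?_
    -- The stronger bound √d is weakened to the stated form with C = 2, which only needs D log d ≥
    -- 1/4; this holds since d ≥ 2.
    have hsqrt : Real.sqrt d ≤ 2 * Real.sqrt (D * d * Real.log d) := by
      have h2 : (2 : ℝ) = Real.sqrt 4 := by
        rw [show (4 : ℝ) = 2 ^ 2 by norm_num, Real.sqrt_sq zero_le_two]
      rw [h2, ← Real.sqrt_mul (by norm_num)]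
      apply Real.sqrt_le_sqrt
      have hd' : (2 : ℝ) ≤ d := by exact_mod_cast hd
      have hD' : (1 : ℝ) ≤ D := by exact_mod_cast hD
      have hlog : 1 / 4 ≤ Real.log d := by
        have := Real.log_le_log two_pos hd'
        linarith [Real.log_two_gt_d9]
      have h1 : 1 / 4 ≤ D * Real.log d := by nlinarith
      nlinarith
    gcongr
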